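/- **Definitions.** A cutting parameter is a sequence $(r_n)_{n\ge 0}$ of natural numbers with $r_n\ge 2$; a corresponding spacer parameter is a sequence $(s_n)_{n\ge 0}$ of finite sequences $s_n=(s_n(1),\dots,s_n(r_n-1))$ of natural numbers. They determine finite binary words $v_0=0$, $v_{n+1}=v_n1^{s_n(1)}v_n1^{s_n(2)}v_n\cdots v_n1^{s_n(r_n-1)}v_n$, each an initial segment of the next, and the infinite word $V=\lim_n v_n$. The symbolic rank-one system is the set $X$ of all $x\in\{0,1\}^{\mathbb Z}$ such that every finite subword of $x$ is a subword of $V$, with the shift $\sigma(x)(i)=x(i+1)$ and a $\sigma$-invariant Borel probability measure $\mu$ on $X$ (which exists and is unique if the spacers are bounded, as they are below). For finite sequences $s,t$ of natural numbers of the same length, $s\perp t$ (incompatible) means that $t$ is not a subword (contiguous block) of $s^\smallfrown(c)^\smallfrown s$ for any $c\in\mathbb N$. Two measure-preserving systems $(X,\mu,T)$ and $(Y,\nu,T')$ are disjoint if $\mu\times\nu$ is the only $T\times T'$-invariant measure on $X\times Y$ with marginals $\mu$ and $\nu$. **Theorem 3.2.** Let $(r_n)$ and $(s_n)$ be cutting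 and spacer parameters giving rise to the symbolic rank-one system $(X,\mu,\sigma)$, and let $(r_n)$ (the same cutting parameter) and $(t_n)$ be cutting and spacer parameters giving rise to the symbolic rank-one system $(Y,\nu,\sigma)$. Suppose that: (a) for all $n$, $\sum_{i=1}^{r_n-1}s_n(i)=\sum_{i=1}^{r_n-1}t_n(i)$; (b) $S\in\mathbb N$ is such that $s_n(i)\le S$ and $t_n(i)\le S$ for all $n$ and all $1\le i\le r_n-1$; (c) there is an $R\in\mathbb N$ such that $r_n\le R$ and $s_n\perp t_n$ for infinitely many $n$; (d) for each integer $k$ with $1<k\le S$, at least one of $(X,\mu,\sigma^k)$ and $(Y,\nu,\sigma^k)$ is ergodic. (In particular this holds if it is true for every $k>1$.) Then $(X,\mu,\sigma)$ and $(Y,\nu,\sigma)$ are disjoint. -/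

import Mathlib

open MeasureTheory

namespace RankOne

/-- `r` is a cutting parameter (`r n ≥ 2`) and `s` is a spacer parameter for it: `s n` is a finite
sequence of natural numbers of length `r n - 1`. -/
structure IsParams (r : ℕ → ℕ) (s : ℕ → List ℕ) : Prop where
  two_le : ∀ n, 2 ≤ r n
  length_add_one : ∀ n, (s n).length + 1 = r n

/-- The generating sequence of finite binary words
`v 0 = 0`, `v (n+1) = v n 1^{a₁} v n ⋯ v n 1^{a_m} v n`, where `s n = (a₁, …, a_m)`. -/
def word (s : ℕ → List ℕ) : ℕ → List (Fin 2)
  | 0 => [0]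
  | n + 1 => word s n ++ (s n).flatMap fun a => List.replicate a 1 ++ word s n

/-- The infinite rank-one word `V = lim v n` (indexed from `0`). For genuine parameters `v i` has
more than `i` letters, and every `v n` is an initial segment of `V`;
see `IsParams.infWord_eq_word_getElem`. -/
def infWord (s : ℕ → List ℕ) (i : ℕ) : Fin 2 := (word s i).getD i 0

theorem word_prefix_succ (s : ℕ → List ℕ) (n : ℕ) : word s n <+: word s (n + 1) :=
  ⟨_, rfl⟩

theorem word_prefix (s : ℕ → List ℕ) {m n : ℕ} (h : m ≤ n) : word s m <+: word s n := by
  induction n, h using Nat.le_induction with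
  | base => exact List.prefix_rfl
  | succ n _ ih => exact ih.trans (word_prefix_succ s n)

theorem IsParams.lt_length_word {r : ℕ → ℕ} {s : ℕ → List ℕ} (h : IsParams r s) (n : ℕ) :
    n < (word s n).length := by
  induction n with
  | zero => simp [word]
  | succ n ih =>
    have h1 := h.two_le n
    have h2 := h.length_add_one n
    obtain ⟨a, l, hl⟩ : ∃ a l, s n = a :: l := by
      cases hs : s n with
      | nil => simp [hs] at h2; omega
      | cons a l => exact ⟨a, l, rfl⟩
    simp only [word, hl, List.flatMap_cons, List.length_append]
    omega

/-- Every `v n` is an initial segment of the infinite word `V`. -/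
theorem IsParams.infWord_eq_word_getElem {r : ℕ → ℕ} {s : ℕ → List ℕ} (h : IsParams r s)
    (n i : ℕ) (hi : i < (word s n).length) : infWord s i = (word s n)[i] := by
  have hi' := h.lt_length_word i
  rw [infWord, List.getD_eq_getElem _ _ hi']
  rcases le_total i n with hin | hin
  · exact (word_prefix s hin).getElem hi'
  · exact ((word_prefix s hin).getElem hi).symm

/-- The shift map on bi-infinite binary sequences. -/
def shift (x : ℤ → Fin 2) : ℤ → Fin 2 := fun i => x (i + 1)

/-- The symbolic rank-one system `X ⊆ {0,1}^ℤ`: all bi-infinite binary sequences `x` such that every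
finite subword `x a, …, x (a + m - 1)` of `x` occurs in the infinite word `V`. As a subtype it
carries the product (equivalently, Borel) σ-algebra. -/
def system (s : ℕ → List ℕ) : Set (ℤ → Fin 2) :=
  {x | ∀ (a : ℤ) (m : ℕ), ∃ b : ℕ, ∀ i < m, x (a + i) = infWord s (b + i)}

theorem shift_mem_system {s : ℕ → List ℕ} {x : ℤ → Fin 2} (hx : x ∈ system s) :
    shift x ∈ system s := by
  intro a m
  obtain ⟨b, hb⟩ := hx (a + 1) m
  refine ⟨b, fun i hi => ?_⟩
  rw [← hb i hi, shift, add_right_comm]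

/-- The shift map restricted to the symbolic rank-one system. -/
def systemShift (s : ℕ → List ℕ) (x : system s) : system s :=
  ⟨shift x, shift_mem_system x.2⟩

/-- `μ` is a shift-invariant Borel probability measure on the symbolic rank-one system of `s`. When
the entries of the spacer parameter are bounded, this determines `μ` uniquely. -/
structure IsSystemMeasure (s : ℕ → List ℕ) (μ : Measure (system s)) : Prop where
  isProbabilityMeasure : IsProbabilityMeasure μ
  invariant : MeasurePreserving (systemShift s) μ μ

/-- Finite sequences `s` and `t` (of the same length) are incompatible, `s ⊥ t`, if `t` is not a
subword (a contiguous block) of `s⌢(c)⌢s` for any natural number `c`. -/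
def Incompatible (s t : List ℕ) : Prop :=
  ∀ c : ℕ, ¬ t <:+: s ++ [c] ++ s

/-- `m` is a joining of `(α, μ, T)` and `(β, ν, S)`: a `T × S`-invariant measure on the product
whose marginals are `μ` and `ν`. -/
structure IsJoining {α β : Type*} [MeasurableSpace α] [MeasurableSpace β]
    (T : α → α) (μ : Measure α) (S : β → β) (ν : Measure β) (m : Measure (α × β)) : Prop where
  invariant : MeasurePreserving (Prod.map T S) m m
  map_fst : m.map Prod.fst = μ
  map_snd : m.map Prod.snd = ν

/-- `(α, μ, T)` and `(β, ν, S)` are disjoint: the product measure is the one and only joining. -/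
def AreDisjoint {α β : Type*} [MeasurableSpace α] [MeasurableSpace β]
    (T : α → α) (μ : Measure α) (S : β → β) (ν : Measure β) : Prop :=
  ∀ m : Measure (α × β), IsJoining T μ S ν m ↔ m = μ.prod ν

end RankOne

/-! Write h for the common length of the level-n words of the two systems, at a level n with `r n ≤
R` and incompatible spacers. In y, take a complete block of level n+1, and in x the nearest block of
level n. The gaps read from there in y spell `t n`, which incompatibility forbids in x, so within at
most R steps the gaps differ: a in x, b in y, with a ≠ b. Until then the gaps agree and the offset
of the blocks is constant, so the last two blocks overlap in a fixed proportion of h. On that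
overlap x has period h+a and y has period h+b (`exists_mismatch`).

Hence, for a positive proportion of times along every orbit of T = σ × σ, the iterate of T by h +
max a b acts on cylinders near the origin as a relative shift: one coordinate moves by |a-b| and the
other stays fixed. The set of such times consists of long runs, so the corresponding sets
`periodicPairs` are almost T-invariant. The mean ergodic theorem, tested against almost invariant
sets, turns this into exact information about a joining m (`exists_invariant_cover`): up to a null
set the space is a finite union of invariant sets D indexed by the pairs a ≠ b, and m restricted to
any invariant subset of D is preserved by the relative shift. Nothing here requires m to be ergodic.

Put k = |a-b|, so 1 ≤ k ≤ S. Invariance under T and under the relative shift gives invariance under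
σ^k × id and under id × σ^k. One of the two k-th powers is ergodic, by hypothesis if k > 1 and by
unique ergodicity if k = 1. This forces the restricted measure to be a multiple of μ × ν
(`eq_smul_prod_of_relative_shift`), and `eq_of_invariant_cover` assembles the pieces. -/

namespace RankOne

/-! ### Parsing the infinite word into blocks and gaps. -/

/-- `build u L` is the word `u 1^{a₁} u ⋯ u 1^{a_m} u`, where `L = (a₁, …, a_m)`. -/
def build (u : List (Fin 2)) (L : List ℕ) : List (Fin 2) :=
  u ++ L.flatMap fun a => List.replicate a 1 ++ u

theorem build_cons (u : List (Fin 2)) (a : ℕ) (L : List ℕ) :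
    build u (a :: L) = u ++ (List.replicate a 1 ++ build u L) := by
  simp [build]

theorem length_build (u : List (Fin 2)) (L : List ℕ) :
    (build u L).length = (L.length + 1) * u.length + L.sum := by
  induction L with
  | nil => simp [build]
  | cons a L ih => simp [build_cons, ih]; ring

theorem getD_build (u : List (Fin 2)) (L : List ℕ) (k i : ℕ) (hk : k ≤ L.length)
    (hi : i < u.length) :
    (build u L).getD (k * u.length + (L.take k).sum + i) 0 = u.getD i 0 := by
  induction L generalizing k with
  | nil =>
    obtain rfl : k = 0 := by simpa using hk
    simp [build]
  | cons a L ih =>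
    rw [build_cons]
    cases k with
    | zero => simp [List.getElem?_append_left hi]
    | succ k =>
      rw [← ih k (by simpa using hk)]
      rw [List.getD_append_right _ _ _ _ (by simp only [List.take_succ_cons, List.sum_cons, add_mul]; omega),
        List.getD_append_right _ _ _ _ (by simp; rw [add_mul]; omega)]
      congr 1
      simp [add_mul]
      omega

theorem length_word_succ (s : ℕ → List ℕ) (n : ℕ) :
    (word s (n + 1)).length = ((s n).length + 1) * (word s n).length + (s n).sum :=
  length_build _ _

/-- The number of spacers between the `j`-th and the `(j+1)`-st block `v n` in the canonical
parsing of the infinite word into blocks `v n` and spacers. -/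
def gap (s : ℕ → List ℕ) (n j : ℕ) : ℕ :=
  -- The first conjunct is there for termination; it follows from the second once `s n` is nonempty.
  -- For genuine parameters the default value 0 is then never used.
  if _h : j / ((s n).length + 1) < j ∧ (j + 1) % ((s n).length + 1) = 0 then
    gap s (n + 1) (j / ((s n).length + 1))
  else (s n).getD (j % ((s n).length + 1)) 0
termination_by j

/-- The position of the `j`-th block `v n` in the canonical parsing of the infinite word. -/
def pos (s : ℕ → List ℕ) (n j : ℕ) : ℕ :=
  ∑ i ∈ Finset.range j, ((word s n).length + gap s n i)

theorem pos_succ (s : ℕ → List ℕ) (n j : ℕ) :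
    pos s n (j + 1) = pos s n j + ((word s n).length + gap s n j) := by
  simp [pos, Finset.sum_range_succ]

theorem gap_le {s : ℕ → List ℕ} {S : ℕ} (hS : ∀ n, ∀ a ∈ s n, a ≤ S) (n j : ℕ) :
    gap s n j ≤ S := by
  induction j using Nat.strong_induction_on generalizing n with
  | _ j ih =>
    rw [gap]
    split_ifs with h
    · exact ih _ h.1 _
    · rcases lt_or_ge (j % ((s n).length + 1)) (s n).length with h' | h'
      · rw [List.getD_eq_getElem _ _ h']
        exact hS n _ (List.getElem_mem _)
      · rw [List.getD_eq_default _ _ h']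
        exact Nat.zero_le _

theorem gap_mul_add (s : ℕ → List ℕ) (n l i : ℕ) (hi : i < (s n).length) :
    gap s n (((s n).length + 1) * l + i) = (s n).getD i 0 := by
  have h1 : (((s n).length + 1) * l + i + 1) % ((s n).length + 1) = i + 1 := by
    rw [add_assoc, Nat.mul_add_mod, Nat.mod_eq_of_lt (by omega)]
  rw [gap, dif_neg (by omega), Nat.mul_add_mod, Nat.mod_eq_of_lt (by omega)]

theorem gap_mul_add_length (s : ℕ → List ℕ) (n l : ℕ) (h : 0 < (s n).length) :
    gap s n (((s n).length + 1) * l + (s n).length) = gap s (n + 1) l := by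
  have h1 : (((s n).length + 1) * l + (s n).length) / ((s n).length + 1) = l := by
    rw [Nat.mul_add_div (by omega), Nat.div_eq_of_lt (by omega), add_zero]
  have h2 : (((s n).length + 1) * l + (s n).length + 1) % ((s n).length + 1) = 0 := by
    rw [add_assoc, Nat.mul_add_mod, Nat.mod_self]
  rw [gap, dif_pos, h1]
  rw [h1]
  exact ⟨by nlinarith, h2⟩

theorem pos_mul_add (s : ℕ → List ℕ) (n l i : ℕ) (hi : i ≤ (s n).length) :
    pos s n (((s n).length + 1) * l + i)
      = pos s n (((s n).length + 1) * l) + (i * (word s n).length + ((s n).take i).sum) := by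
  induction i with
  | zero => simp
  | succ i ih =>
    rw [← add_assoc, pos_succ, ih (by omega), gap_mul_add s n l i (by omega),
      List.getD_eq_getElem _ _ (by omega), List.sum_take_succ _ _ (by omega)]
    ring

theorem pos_mul (s : ℕ → List ℕ) (n l : ℕ) (h : 0 < (s n).length) :
    pos s n (((s n).length + 1) * l) = pos s (n + 1) l := by
  induction l with
  | zero => simp [pos]
  | succ l ih =>
    rw [show ((s n).length + 1) * (l + 1) = ((s n).length + 1) * l + (s n).length + 1 by ring,
      pos_succ, pos_mul_add s n l _ le_rfl, ih, pos_succ, gap_mul_add_length s n l h,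
      length_word_succ, List.take_length]
    ring

theorem IsParams.length_pos {r : ℕ → ℕ} {s : ℕ → List ℕ} (h : IsParams r s) (n : ℕ) :
    0 < (s n).length := by
  have h1 := h.two_le n
  have h2 := h.length_add_one n
  omega

theorem IsParams.infWord_eq_getD {r : ℕ → ℕ} {s : ℕ → List ℕ} (h : IsParams r s)
    (n i : ℕ) (hi : i < (word s n).length) : infWord s i = (word s n).getD i 0 := by
  rw [h.infWord_eq_word_getElem n i hi, List.getD_eq_getElem _ _ hi]

/-- The j-th block of level n lies in block j / (k+1) of level n+1, where k is the length of `s n`.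
This index is smaller than j when j > 0, so strong induction on j, with the level free to grow,
reduces everything to the initial block. -/
theorem IsParams.infWord_pos_add {r : ℕ → ℕ} {s : ℕ → List ℕ} (h : IsParams r s)
    (n j i : ℕ) (hi : i < (word s n).length) : infWord s (pos s n j + i) = infWord s i := by
  induction j using Nat.strong_induction_on generalizing n i with
  | _ j ih =>
    rcases Nat.eq_zero_or_pos j with rfl | hj
    · simp [pos]
    have hn := h.length_pos n
    set k := (s n).length with hk
    have hmod : j % (k + 1) ≤ (s n).length := by
      have := Nat.mod_lt j (by omega : 0 < k + 1)
      omega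
    have hlt : j / (k + 1) < j := Nat.div_lt_self hj (by omega)
    have hlen : j % (k + 1) * (word s n).length + ((s n).take (j % (k + 1))).sum + i
        < (word s (n + 1)).length := by
      rw [length_word_succ]
      have h1 : ((s n).take (j % (k + 1))).sum ≤ (s n).sum :=
        (List.take_sublist _ _).sum_le_sum (by simp)
      nlinarith
    calc infWord s (pos s n j + i)
        = infWord s (pos s (n + 1) (j / (k + 1))
            + (j % (k + 1) * (word s n).length + ((s n).take (j % (k + 1))).sum + i)) := by
          conv_lhs => rw [← Nat.div_add_mod j (k + 1)]
          rw [pos_mul_add s n _ _ hmod, pos_mul s n _ hn]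
          congr 1
          ring
      _ = infWord s (j % (k + 1) * (word s n).length + ((s n).take (j % (k + 1))).sum + i) :=
          ih _ hlt _ _ hlen
      _ = infWord s i := by
          rw [h.infWord_eq_getD (n + 1) _ hlen, h.infWord_eq_getD n i hi]
          exact getD_build _ _ _ _ hmod hi

theorem IsParams.le_pos {r : ℕ → ℕ} {s : ℕ → List ℕ} (h : IsParams r s) (n j : ℕ) :
    j ≤ pos s n j := by
  induction j with
  | zero => simp
  | succ j ih =>
    have := h.lt_length_word n
    rw [pos_succ]
    omega

/-- Every position lies in exactly one block (with the spacers following it). -/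
theorem IsParams.exists_pos_le_lt {r : ℕ → ℕ} {s : ℕ → List ℕ} (h : IsParams r s) (n b : ℕ) :
    ∃ j, pos s n j ≤ b ∧ b < pos s n (j + 1) := by
  have hex : ∃ j, b < pos s n (j + 1) := ⟨b, h.le_pos n (b + 1)⟩
  classical
  refine ⟨Nat.find hex, ?_, Nat.find_spec hex⟩
  rcases hj : Nat.find hex with _ | j
  · simp [pos]
  · exact not_lt.1 (Nat.find_min hex (m := j) (by omega))

/-- This is where the equality of spacer sums enters: with equal block lengths, blocks of x and y
keep their relative offset as long as the gaps agree. -/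
theorem length_word_eq {r : ℕ → ℕ} {s t : ℕ → List ℕ} (hs : IsParams r s) (ht : IsParams r t)
    (hst : ∀ n, (s n).sum = (t n).sum) (n : ℕ) : (word s n).length = (word t n).length := by
  induction n with
  | zero => rfl
  | succ n ih =>
    rw [length_word_succ, length_word_succ, ih, hst, hs.length_add_one, ht.length_add_one]

/-! ### Incompatible spacers force different periods. -/

/-- If `s n` and `t` are incompatible, then `t` does not occur among the gaps of the parsing into
blocks `v n`. -/
theorem exists_gap_ne {s : ℕ → List ℕ} {n : ℕ} {t : List ℕ} (hn : 0 < (s n).length)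
    (hlen : t.length = (s n).length) (hinc : Incompatible (s n) t) (l : ℕ) :
    ∃ i < t.length, gap s n (l + i) ≠ t.getD i 0 := by
  by_contra! hcon
  set k := (s n).length with hk
  set e := l % (k + 1) with he
  set q := l / (k + 1) with hq
  have hl : (k + 1) * q + e = l := Nat.div_add_mod l (k + 1)
  have hek : e < k + 1 := Nat.mod_lt _ (Nat.succ_pos k)
  -- Among k consecutive gaps of level n at most one separates two blocks of level n+1, so they form
  -- a subword of `s n`, that gap, `s n`.
  refine hinc (gap s (n + 1) q) ?_
  have heq : t = ((s n ++ [gap s (n + 1) q] ++ s n).drop e).take k := by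
    refine List.ext_getElem (by simp; omega) fun i h1 h2 => ?_
    rw [← List.getD_eq_getElem t 0 h1, ← hcon i h1, List.getElem_take, List.getElem_drop]
    rcases lt_trichotomy (e + i) k with h | h | h
    · rw [List.getElem_append_left (by simp; omega), List.getElem_append_left (by omega),
        ← hl, add_assoc, gap_mul_add s n q _ h, List.getD_eq_getElem]
    · rw [List.getElem_append_left (by simp; omega), List.getElem_append_right (by omega)]
      simp only [List.getElem_singleton]
      rw [← hl, add_assoc, h, hk, gap_mul_add_length s n q hn]
    · rw [List.getElem_append_right (by simp; omega)]
      have h3 : l + i = (k + 1) * (q + 1) + (e + i - (k + 1)) := by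
        rw [← hl, mul_add]; omega
      rw [h3, gap_mul_add s n _ _ (by omega), List.getD_eq_getElem _ _ (by omega)]
      congr 1
      simp
      omega
  rw [heq]
  exact (List.take_prefix _ _).isInfix.trans (List.drop_suffix _ _).isInfix

/-- Inside the `j`-th block `v n`, passing to the next block does not change the letter. -/
theorem IsParams.apply_add_gap {r : ℕ → ℕ} {s : ℕ → List ℕ} (h : IsParams r s) {x : ℤ → Fin 2}
    {b m : ℕ} (hx : ∀ i < m, x i = infWord s (b + i)) (n j : ℕ) {u : ℤ} (hu0 : 0 ≤ u)
    (hu1 : (pos s n j : ℤ) ≤ b + u) (hu2 : b + u < (pos s n j : ℤ) + (word s n).length)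
    (hu3 : u + (word s n).length + gap s n j < m) :
    x (u + (word s n).length + gap s n j) = x u := by
  obtain ⟨v, rfl⟩ := Int.eq_ofNat_of_zero_le hu0
  obtain ⟨e, he⟩ := Nat.exists_eq_add_of_le (show pos s n j ≤ b + v by exact_mod_cast hu1)
  have he' : e < (word s n).length := by omega
  have h1 := hx (v + (word s n).length + gap s n j) (by omega)
  have h2 := hx v (by omega)
  push_cast at h1
  rw [h1, h2, he, h.infWord_pos_add n j e he',
    ← h.infWord_pos_add n (j + 1) e he', pos_succ]
  congr 1
  omega

theorem pos_add_le {s : ℕ → List ℕ} {S : ℕ} (hS : ∀ n, ∀ a ∈ s n, a ≤ S) (n j i : ℕ) :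
    pos s n (j + i) ≤ pos s n j + i * ((word s n).length + S) := by
  induction i with
  | zero => simp
  | succ i ih =>
    rw [← add_assoc, pos_succ, add_mul]
    have := gap_le hS n (j + i)
    omega

/-- Nearly aligned blocks of x and y are followed until their gaps first differ, which
incompatibility forces within one block of level n+1. There the two blocks overlap in length at
least (h-S)/2, and each letter of the overlap recurs at distance h+a in x and h+b in y. -/
theorem exists_mismatch {r : ℕ → ℕ} {s t : ℕ → List ℕ} (hs : IsParams r s) (ht : IsParams r t)
    (hst : ∀ n, (s n).sum = (t n).sum) {S : ℕ} (hsS : ∀ n, ∀ a ∈ s n, a ≤ S)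
    (htS : ∀ n, ∀ a ∈ t n, a ≤ S) {n R : ℕ} (hR : r n ≤ R) (hinc : Incompatible (s n) (t n))
    (hS : 8 * S ≤ (word s n).length) {x y : ℤ → Fin 2} (hx : x ∈ system s) (hy : y ∈ system t) :
    ∃ a ≤ S, ∃ b ≤ S, a ≠ b ∧ ∃ c : ℕ,
      c + (word s n).length / 8 ≤ (4 * R + 8) * (word s n).length ∧
      ∀ i < (word s n).length / 8, ∀ j : ℤ, |j| ≤ ((word s n).length / 8 : ℕ) →
        x (c + i + j + (word s n).length + a) = x (c + i + j) ∧
        y (c + i + j + (word s n).length + b) = y (c + i + j) := by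
  have hlen := length_word_eq hs ht hst n
  set h := (word s n).length with hh
  set m := (4 * R + 12) * h with hm
  obtain ⟨bs, hbs⟩ := hx 0 m
  obtain ⟨bt, hbt⟩ := hy 0 m
  simp only [zero_add] at hbs hbt
  have hsn := hs.length_pos n
  have htn := ht.length_pos n
  have hl1 := hs.length_add_one n
  have hl2 := ht.length_add_one n
  -- the first complete block of level `n + 1` in `y`
  obtain ⟨l, hl, hl'⟩ := ht.exists_pos_le_lt (n + 1) (bt + (h + S))
  set q := ((t n).length + 1) * (l + 1) with hq
  have hq1 : pos t n q = pos t (n + 1) (l + 1) := pos_mul t n (l + 1) htn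
  have hq2 : pos t n q ≤ bt + (h + S) + R * (h + S) := by
    have e1 := pos_add_le htS n (((t n).length + 1) * l) ((t n).length + 1)
    rw [← mul_add_one, ← hq, pos_mul t n l htn, ← hlen] at e1
    have e2 : ((t n).length + 1) * (h + S) ≤ R * (h + S) := Nat.mul_le_mul_right _ (by omega)
    omega
  -- the block `v n` in `x` that is closest to it
  obtain ⟨p, hp1, hp2⟩ : ∃ p, 2 * (bs + pos t n q) ≤ 2 * (bt + pos s n p) + (h + S) ∧
      2 * (bt + pos s n p) ≤ 2 * (bs + pos t n q) + (h + S) := by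
    obtain ⟨p, hp, hp'⟩ := hs.exists_pos_le_lt n (bs + (pos t n q - bt))
    have := pos_succ s n p
    have := gap_le hsS n p
    rcases le_total (2 * (bs + pos t n q)) (2 * (bt + pos s n p) + (h + S)) with h1 | h1
    · exact ⟨p, h1, by omega⟩
    · exact ⟨p + 1, by omega, by omega⟩
  have hex := exists_gap_ne hsn (by omega : (t n).length = (s n).length) hinc p
  classical
  obtain ⟨hi1, hi2⟩ := Nat.find_spec hex
  have hmin : ∀ i' < Nat.find hex, gap s n (p + i') = gap t n (q + i') := by
    intro i' hi'
    have h1 := Nat.find_min hex hi'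
    rw [hq, gap_mul_add t n _ _ (by omega)]
    by_contra h2
    exact h1 ⟨by omega, h2⟩
  generalize Nat.find hex = i at hi1 hi2 hmin
  rw [← gap_mul_add t n (l + 1) i hi1, ← hq] at hi2
  have hoff : ∀ i' ≤ i, pos s n (p + i') + pos t n q = pos t n (q + i') + pos s n p := by
    intro i' hi'
    induction i' with
    | zero => simp [add_comm]
    | succ i' ih =>
      have h1 := ih (by omega)
      have h2 := hmin i' (by omega)
      rw [← add_assoc, ← add_assoc, pos_succ, pos_succ, ← hlen, ← hh, h2]
      omega
  have hoff := hoff i le_rfl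
  have ha := gap_le hsS n (p + i)
  have hb := gap_le htS n (q + i)
  have hqi : pos t n (q + i) ≤ pos t n q + R * (h + S) := by
    refine (pos_add_le htS n q i).trans ?_
    rw [← hlen]
    gcongr
    omega
  have hqi' : pos t n q ≤ pos t n (q + i) :=
    Finset.sum_le_sum_of_subset (Finset.range_mono (by omega))
  have hRS : R * (h + S) ≤ 2 * (R * h) := by nlinarith
  have hm' : m = 4 * (R * h) + 12 * h := by rw [hm]; ring
  have hW : (4 * R + 8) * h = 4 * (R * h) + 8 * h := by ring
  rw [hW]
  refine ⟨_, ha, _, hb, hi2,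
    -- The overlap starts at the maximum and, since `8 * S ≤ h`, has length at least 7h/16. Starting
    -- h/8 inside it leaves room for i < h/8 and |j| ≤ h/8, as only 3h/8 is needed.
    max (pos s n (p + i) - bs) (pos t n (q + i) - bt) + h / 8, by omega, ?_⟩
  intro e he j hj
  rw [abs_le] at hj
  constructor
  · apply hs.apply_add_gap hbs <;> omega
  · rw [hlen]
    apply ht.apply_add_gap hbt <;> omega

open Filter Topology symmDiff

/-! ### Almost invariant sets and the mean ergodic theorem. -/

section AbstractErgodic

variable {α : Type*} [MeasurableSpace α] {m : Measure α} {T : α → α}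

/-- By invariance, one more step of T on `C` can be traded for one on `A`, at the cost of one
symmetric difference. -/
theorem abs_measureReal_inter_preimage_sub_le [IsFiniteMeasure m] (hT : MeasurePreserving T m m)
    {A C : Set α} (hA : MeasurableSet A) (hC : MeasurableSet C) (q j : ℕ) :
    |m.real (A ∩ T^[q + j] ⁻¹' C) - m.real (A ∩ T^[q] ⁻¹' C)| ≤ j * m.real ((T ⁻¹' A) ∆ A) := by
  induction j with
  | zero => simp
  | succ j ih =>
    have hC' : MeasurableSet (T^[q + j] ⁻¹' C) := (hT.iterate (q + j)).measurable hC
    have h1 : m.real (A ∩ T^[q + j] ⁻¹' C) = m.real (T ⁻¹' A ∩ T^[q + j + 1] ⁻¹' C) := by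
      rw [Function.iterate_succ, Set.preimage_comp, ← Set.preimage_inter]
      exact (hT.measureReal_preimage (hA.inter hC').nullMeasurableSet).symm
    have h2 : |m.real (A ∩ T^[q + j + 1] ⁻¹' C) - m.real (T ⁻¹' A ∩ T^[q + j + 1] ⁻¹' C)|
        ≤ m.real ((T ⁻¹' A) ∆ A) := by
      refine (abs_measureReal_sub_le_measureReal_symmDiff
        (hA.inter ((hT.iterate (q + j + 1)).measurable hC)).nullMeasurableSet
        ((hT.measurable hA).inter
          ((hT.iterate (q + j + 1)).measurable hC)).nullMeasurableSet).trans ?_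
      refine measureReal_mono ?_
      rintro z (⟨⟨h1, h2⟩, h3⟩ | ⟨⟨h1, h2⟩, h3⟩)
      · exact Or.inr ⟨h1, fun h => h3 ⟨h, h2⟩⟩
      · exact Or.inl ⟨h1, fun h => h3 ⟨h, h2⟩⟩
    rw [← h1] at h2
    rw [← add_assoc]
    push_cast
    calc _ = |(m.real (A ∩ T^[q + j + 1] ⁻¹' C) - m.real (A ∩ T^[q + j] ⁻¹' C)) +
        (m.real (A ∩ T^[q + j] ⁻¹' C) - m.real (A ∩ T^[q] ⁻¹' C))| := by congr 1; ring
      _ ≤ _ := (abs_add_le _ _).trans (by linarith)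

/-- `ψ` is a version of the conditional expectation of the indicator function of `C` with respect
to the invariant sets, expressed through almost invariant sets. -/
structure IsInvariantDensity (T : α → α) (m : Measure α) (C : Set α) (ψ : α → ℝ) : Prop where
  measurable : Measurable ψ
  integrable : Integrable ψ m
  comp_ae_eq : ψ ∘ T =ᵐ[m] ψ
  approx : ∀ ε > 0, ∃ N : ℕ, ∀ A, MeasurableSet A → ∀ q : ℕ,
    |m.real (A ∩ T^[q] ⁻¹' C) - ∫ z in A, ψ z ∂m| ≤ ε + N * m.real ((T ⁻¹' A) ∆ A)

/-- The mean ergodic theorem for an indicator function, tested against almost invariant sets. -/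
theorem exists_isInvariantDensity [IsProbabilityMeasure m] (hT : MeasurePreserving T m m)
    {C : Set α} (hC : MeasurableSet C) :
    ∃ ψ : α → ℝ, IsInvariantDensity T m C ψ := by
  set U := (Lp.compMeasurePreservingₗᵢ (E := ℝ) (p := 2) ℝ T hT).toContinuousLinearMap with hU
  set φ := indicatorConstLp 2 hC (measure_ne_top m C) (1 : ℝ) with hφ
  set Q := (U.eqLocus (1 : Lp ℝ 2 m →L[ℝ] Lp ℝ 2 m)).orthogonalProjectionOnto φ with hQ
  have hlim : Tendsto (birkhoffAverage ℝ U _root_.id · φ) atTop (𝓝 (Q : Lp ℝ 2 m)) :=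
    U.tendsto_birkhoffAverage_orthogonalProjection
      (LinearIsometry.norm_toContinuousLinearMap_le _) φ
  have hUQ : Lp.compMeasurePreserving T hT (Q : Lp ℝ 2 m) = Q := Q.2
  have hUj : ∀ j, (⇑U)^[j] φ = indicatorConstLp 2 ((hT.iterate j).measurable hC)
      (measure_ne_top m _) (1 : ℝ) := fun j => by
    rw [show ⇑U = Lp.compMeasurePreserving T hT from rfl, Lp.compMeasurePreserving_iterate]
    rfl
  refine ⟨(Q : Lp ℝ 2 m), (Lp.stronglyMeasurable _).measurable,
    (Lp.memLp (Q : Lp ℝ 2 m)).integrable one_le_two, ?_, ?_⟩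
  · have := Lp.coeFn_compMeasurePreserving (Q : Lp ℝ 2 m) hT
    rw [hUQ] at this
    exact this.symm
  intro ε hε
  -- `N` comes from norm convergence of the averages of the indicator of `C`, hence does not depend
  -- on `A` or `q`.
  obtain ⟨N, hN, hN0⟩ := ((Metric.tendsto_nhds.1 hlim ε hε).and (eventually_gt_atTop 0)).exists
  refine ⟨N, fun A hA q => ?_⟩
  set V := Lp.compMeasurePreservingₗᵢ (E := ℝ) (p := 2) ℝ T^[q] (hT.iterate q) with hV
  set g := indicatorConstLp 2 hA (measure_ne_top m A) (1 : ℝ) with hg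
  have hVQ : V (Q : Lp ℝ 2 m) = Q := by
    change Lp.compMeasurePreserving T^[q] (hT.iterate q) (Q : Lp ℝ 2 m) = Q
    rw [← Lp.compMeasurePreserving_iterate]
    exact Function.iterate_fixed hUQ q
  have hgnorm : ‖g‖ ≤ 1 := by
    rw [hg, norm_indicatorConstLp (by norm_num) (by norm_num)]
    simp only [norm_one, one_mul]
    exact Real.rpow_le_one measureReal_nonneg measureReal_le_one (by positivity)
  have hgφ : inner ℝ g (V (birkhoffAverage ℝ U _root_.id N φ))
      = (N : ℝ)⁻¹ * ∑ j ∈ Finset.range N, m.real (A ∩ T^[q + j] ⁻¹' C) := by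
    simp only [birkhoffAverage, birkhoffSum, _root_.id]
    rw [map_smul, map_sum, inner_smul_right, inner_sum]
    congr 1
    refine Finset.sum_congr rfl fun j _ => ?_
    rw [hUj j]
    have : V (indicatorConstLp 2 ((hT.iterate j).measurable hC) (measure_ne_top m _) (1 : ℝ))
        = indicatorConstLp 2 ((hT.iterate q).measurable ((hT.iterate j).measurable hC))
          (measure_ne_top m _) (1 : ℝ) := rfl
    rw [this, L2.real_inner_indicatorConstLp_one_indicatorConstLp_one, ← Set.preimage_comp,
      ← Function.iterate_add, add_comm j q]
  have hgQ : inner ℝ g (Q : Lp ℝ 2 m) = ∫ z in A, (Q : Lp ℝ 2 m) z ∂m :=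
    L2.inner_indicatorConstLp_one hA _ _
  -- The estimate is uniform in `q` because composition with `T^[q]` is an isometry that fixes the
  -- projection.
  have h1 : |inner ℝ g (V (birkhoffAverage ℝ U _root_.id N φ)) - inner ℝ g (Q : Lp ℝ 2 m)|
      ≤ ε := by
    rw [← inner_sub_right]
    rw [show V (birkhoffAverage ℝ U _root_.id N φ) - (Q : Lp ℝ 2 m)
      = V (birkhoffAverage ℝ U _root_.id N φ - (Q : Lp ℝ 2 m)) by rw [map_sub, hVQ]]
    refine (abs_real_inner_le_norm _ _).trans ?_
    rw [V.norm_map, ← dist_eq_norm]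
    nlinarith [dist_nonneg (x := birkhoffAverage ℝ U _root_.id N φ) (y := (Q : Lp ℝ 2 m)),
      norm_nonneg g]
  have h2 : |m.real (A ∩ T^[q] ⁻¹' C) - inner ℝ g (V (birkhoffAverage ℝ U _root_.id N φ))|
      ≤ N * m.real ((T ⁻¹' A) ∆ A) := by
    have hN' : (0 : ℝ) < N := by exact_mod_cast hN0
    have h3 : m.real (A ∩ T^[q] ⁻¹' C) - inner ℝ g (V (birkhoffAverage ℝ U _root_.id N φ))
        = (N : ℝ)⁻¹ * ∑ j ∈ Finset.range N,
          (m.real (A ∩ T^[q] ⁻¹' C) - m.real (A ∩ T^[q + j] ⁻¹' C)) := by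
      rw [hgφ, Finset.sum_sub_distrib, Finset.sum_const, Finset.card_range, nsmul_eq_mul]
      field_simp
    rw [h3, abs_mul, abs_of_pos (inv_pos.2 hN'), inv_mul_le_iff₀ hN']
    calc _ ≤ ∑ j ∈ Finset.range N, (N : ℝ) * m.real ((T ⁻¹' A) ∆ A) := by
          refine (Finset.abs_sum_le_sum_abs _ _).trans (Finset.sum_le_sum fun j hj => ?_)
          rw [abs_sub_comm]
          refine (abs_measureReal_inter_preimage_sub_le hT hA hC q j).trans ?_
          gcongr
          exact (Finset.mem_range.1 hj).le
      _ = _ := by rw [Finset.sum_const, Finset.card_range, nsmul_eq_mul]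
  rw [← hgQ]
  calc _ ≤ _ := abs_sub_le _ (inner ℝ g (V (birkhoffAverage ℝ U _root_.id N φ))) _
    _ ≤ _ := by linarith

/-- Sets that asymptotically miss `A n` form a `σ`-ideal. -/
theorem tendsto_measureReal_inter_iUnion [IsFiniteMeasure m] {ι : Type*} [Countable ι]
    {A : ℕ → Set α} {E : ι → Set α} (hE : ∀ i, MeasurableSet (E i))
    (h : ∀ i, Tendsto (fun n => m.real (A n ∩ E i)) atTop (𝓝 0)) :
    Tendsto (fun n => m.real (A n ∩ ⋃ i, E i)) atTop (𝓝 0) := by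
  have hmono : Monotone fun s : Finset ι => ⋃ i ∈ s, E i :=
    fun s t hst => Set.biUnion_subset_biUnion_left hst
  have hlim := tendsto_measure_iUnion_atTop (μ := m) hmono
  rw [← Set.iUnion_eq_iUnion_finset] at hlim
  have hlim' : Tendsto (fun s : Finset ι => m.real (⋃ i ∈ s, E i)) atTop
      (𝓝 (m.real (⋃ i, E i))) :=
    (ENNReal.tendsto_toReal (measure_ne_top m _)).comp hlim
  rw [Metric.tendsto_atTop]
  intro ε hε
  obtain ⟨s, hs⟩ := (Metric.tendsto_nhds.1 hlim' (ε / 2) (by positivity)).exists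
  have hsum : Tendsto (fun n => ∑ i ∈ s, m.real (A n ∩ E i)) atTop (𝓝 0) := by
    simpa using tendsto_finsetSum s fun i _ => h i
  obtain ⟨n₀, hn₀⟩ := Metric.tendsto_atTop.1 hsum (ε / 2) (by positivity)
  refine ⟨n₀, fun n hn => ?_⟩
  have h1 := hn₀ n hn
  have hsub : (⋃ i ∈ s, E i) ⊆ ⋃ i, E i := Set.iUnion₂_subset fun i _ => Set.subset_iUnion E i
  have h2 : m.real ((⋃ i, E i) \ ⋃ i ∈ s, E i) = m.real (⋃ i, E i) - m.real (⋃ i ∈ s, E i) :=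
    measureReal_sdiff hsub (s.measurableSet_biUnion fun i _ => hE i)
  have h3 : m.real (A n ∩ ⋃ i, E i)
      ≤ m.real (⋃ i ∈ s, A n ∩ E i) + m.real ((⋃ i, E i) \ ⋃ i ∈ s, E i) := by
    refine (measureReal_mono ?_).trans (measureReal_union_le _ _)
    rintro z ⟨hz1, hz2⟩
    by_cases hz : z ∈ ⋃ i ∈ s, E i
    · left
      rw [← Set.inter_iUnion₂]
      exact ⟨hz1, hz⟩
    · exact Or.inr ⟨hz2, hz⟩
  have h4 : m.real (⋃ i ∈ s, A n ∩ E i) ≤ ∑ i ∈ s, m.real (A n ∩ E i) :=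
    measureReal_biUnion_finset_le _ _
  rw [Real.dist_eq, sub_zero, abs_of_nonneg measureReal_nonneg]
  rw [Real.dist_eq, abs_lt] at hs h1
  linarith [hs.1, h1.2]

theorem preimage_inter_symmDiff_subset {β : Type*} (T : β → β) (A E : Set β) :
    (T ⁻¹' (A ∩ E)) ∆ (A ∩ E) ⊆ (T ⁻¹' A) ∆ A ∪ (T ⁻¹' E) ∆ E := by
  rintro z (⟨⟨h1, h2⟩, h3⟩ | ⟨⟨h1, h2⟩, h3⟩)
  · by_cases h : z ∈ A
    · exact Or.inr (Or.inl ⟨h2, fun h' => h3 ⟨h, h'⟩⟩)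
    · exact Or.inl (Or.inl ⟨h1, h⟩)
  · by_cases h : T z ∈ A
    · exact Or.inr (Or.inr ⟨h2, fun h' => h3 ⟨h, h'⟩⟩)
    · exact Or.inl (Or.inr ⟨h1, h⟩)

theorem measureReal_preimage_inter_symmDiff_le [IsFiniteMeasure m] (A : Set α) {E : Set α}
    (hE : T ⁻¹' E =ᵐ[m] E) :
    m.real ((T ⁻¹' (A ∩ E)) ∆ (A ∩ E)) ≤ m.real ((T ⁻¹' A) ∆ A) := by
  refine (measureReal_mono (preimage_inter_symmDiff_subset T A E)).trans ?_
  refine (measureReal_union_le _ _).trans ?_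
  have : m.real ((T ⁻¹' E) ∆ E) = 0 := by
    rw [measureReal_def, measure_symmDiff_eq_zero_iff.2 hE]
    rfl
  rw [this, add_zero]

namespace IsInvariantDensity

variable {C C' : Set α} {ψ ψ' : α → ℝ}

theorem measureReal_inter_eq [IsFiniteMeasure m] (h : IsInvariantDensity T m C ψ) {E : Set α}
    (hE : MeasurableSet E) (hTE : T ⁻¹' E =ᵐ[m] E) : m.real (E ∩ C) = ∫ z in E, ψ z ∂m := by
  have h0 : m.real ((T ⁻¹' E) ∆ E) = 0 := by
    rw [measureReal_def, measure_symmDiff_eq_zero_iff.2 hTE]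
    rfl
  rw [← sub_eq_zero, ← abs_nonpos_iff]
  refine le_of_forall_pos_le_add fun ε hε => ?_
  obtain ⟨N, hN⟩ := h.approx ε hε
  simpa [h0] using hN E hE 0

/-- On the invariant set where ψ - ψ' ≥ δ, the integrals of ψ and ψ' over the part of `A n`
approximate the same number. Their difference is at least δ times the measure of that part, which
therefore tends to 0; then take the union over δ = 1/(k+1). -/
theorem tendsto_inter_lt [IsFiniteMeasure m] (h : IsInvariantDensity T m C ψ)
    (h' : IsInvariantDensity T m C' ψ') {A : ℕ → Set α} (hA : ∀ n, MeasurableSet (A n))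
    (hTA : Tendsto (fun n => m.real ((T ⁻¹' A n) ∆ A n)) atTop (𝓝 0)) {q q' : ℕ → ℕ}
    (hq : ∀ᶠ n in atTop, A n ∩ T^[q n] ⁻¹' C = A n ∩ T^[q' n] ⁻¹' C') :
    Tendsto (fun n => m.real (A n ∩ {z | ψ' z < ψ z})) atTop (𝓝 0) := by
  have hU : {z | ψ' z < ψ z} = ⋃ k : ℕ, {z | 1 / ((k : ℝ) + 1) ≤ ψ z - ψ' z} := by
    ext z
    simp only [Set.mem_ofPred_eq, Set.mem_iUnion]
    constructor
    · intro hz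
      obtain ⟨k, hk⟩ := exists_nat_one_div_lt (sub_pos.2 hz)
      exact ⟨k, hk.le⟩
    · rintro ⟨k, hk⟩
      have : 0 < 1 / ((k : ℝ) + 1) := by positivity
      linarith
  have hE : ∀ k : ℕ, MeasurableSet {z | 1 / ((k : ℝ) + 1) ≤ ψ z - ψ' z} := fun k =>
    measurableSet_le measurable_const (h.measurable.sub h'.measurable)
  rw [hU]
  refine tendsto_measureReal_inter_iUnion hE fun k => ?_
  set δ : ℝ := 1 / ((k : ℝ) + 1) with hδ
  have hδ0 : 0 < δ := by positivity
  set E := {z | δ ≤ ψ z - ψ' z} with hEdef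
  have hTE : T ⁻¹' E =ᵐ[m] E := by
    filter_upwards [h.comp_ae_eq, h'.comp_ae_eq] with z hz hz'
    simp only [Function.comp_apply] at hz hz'
    refine propext ?_
    change δ ≤ ψ (T z) - ψ' (T z) ↔ δ ≤ ψ z - ψ' z
    rw [hz, hz']
  rw [Metric.tendsto_atTop]
  intro ε hε
  -- Three errors of size δε/4 arise: one from each density and one from the symmetric differences
  -- together.
  obtain ⟨N, hN⟩ := h.approx (δ * ε / 4) (by positivity)
  obtain ⟨N', hN'⟩ := h'.approx (δ * ε / 4) (by positivity)
  have hlim : Tendsto (fun n => ((N : ℝ) + N') * m.real ((T ⁻¹' A n) ∆ A n)) atTop (𝓝 0) := by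
    simpa using hTA.const_mul ((N : ℝ) + N')
  obtain ⟨n₀, hn₀⟩ := eventually_atTop.1
    (((Metric.tendsto_nhds.1 hlim (δ * ε / 4) (by positivity))).and hq)
  refine ⟨n₀, fun n hn => ?_⟩
  obtain ⟨h1, h2⟩ := hn₀ n hn
  have hAE := (hA n).inter (hE k)
  have h3 := hN _ hAE (q n)
  have h4 := hN' _ hAE (q' n)
  have h5 : A n ∩ E ∩ T^[q n] ⁻¹' C = A n ∩ E ∩ T^[q' n] ⁻¹' C' := by
    rw [Set.inter_right_comm, h2, Set.inter_right_comm]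
  rw [h5] at h3
  have h6 : δ * m.real (A n ∩ E) ≤ (∫ z in A n ∩ E, ψ z ∂m) - ∫ z in A n ∩ E, ψ' z ∂m := by
    rw [← integral_sub h.integrable.integrableOn h'.integrable.integrableOn]
    have := setIntegral_mono_on (μ := m) (s := A n ∩ E) (f := fun _ => δ)
      (g := fun z => ψ z - ψ' z) (integrable_const δ)
      (h.integrable.sub h'.integrable).integrableOn hAE fun z hz => hz.2
    rw [setIntegral_const, smul_eq_mul] at this
    linarith
  have h7 := measureReal_preimage_inter_symmDiff_le (A n) hTE
  have h8 : (0 : ℝ) ≤ N := Nat.cast_nonneg _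
  have h9 : (0 : ℝ) ≤ N' := Nat.cast_nonneg _
  have h10 := mul_le_mul_of_nonneg_left h7 h8
  have h11 := mul_le_mul_of_nonneg_left h7 h9
  rw [Real.dist_eq, sub_zero, abs_lt] at h1
  rw [abs_le] at h3 h4
  rw [Real.dist_eq, sub_zero, abs_of_nonneg measureReal_nonneg]
  have h12 : δ * m.real (A n ∩ E) < δ * ε := by
    have := h1.2
    nlinarith [h3.1, h4.2, mul_pos hδ0 hε]
  exact lt_of_mul_lt_mul_left h12 hδ0.le

theorem tendsto_inter_ne [IsFiniteMeasure m] (h : IsInvariantDensity T m C ψ)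
    (h' : IsInvariantDensity T m C' ψ') {A : ℕ → Set α} (hA : ∀ n, MeasurableSet (A n))
    (hTA : Tendsto (fun n => m.real ((T ⁻¹' A n) ∆ A n)) atTop (𝓝 0)) {q q' : ℕ → ℕ}
    (hq : ∀ᶠ n in atTop, A n ∩ T^[q n] ⁻¹' C = A n ∩ T^[q' n] ⁻¹' C') :
    Tendsto (fun n => m.real (A n ∩ {z | ψ z ≠ ψ' z})) atTop (𝓝 0) := by
  have h1 := h.tendsto_inter_lt h' hA hTA hq
  have h2 := h'.tendsto_inter_lt h hA hTA (hq.mono fun n hn => hn.symm)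
  refine squeeze_zero (fun n => measureReal_nonneg) (fun n => ?_) (by simpa using h1.add h2)
  refine (measureReal_mono ?_).trans (measureReal_union_le _ _)
  rintro z ⟨hz1, hz2⟩
  rcases lt_or_gt_of_ne (show ψ z ≠ ψ' z from hz2) with hz | hz
  · exact Or.inr ⟨hz1, hz⟩
  · exact Or.inl ⟨hz1, hz⟩

end IsInvariantDensity

/-- If every orbit segment of length `W` meets `G` at least `L` times, then `G` occupies at least
the proportion `L / W` of every invariant set. -/
theorem mul_measureReal_le_of_card [IsFiniteMeasure m] (hT : MeasurePreserving T m m) {G : Set α}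
    (hG : MeasurableSet G) {L W : ℕ}
    (hcard : ∀ z, ∃ c, c + L ≤ W ∧ ∀ i < L, T^[c + i] z ∈ G) {E : Set α} (hE : MeasurableSet E)
    (hTE : T ⁻¹' E =ᵐ[m] E) : L * m.real E ≤ W * m.real (G ∩ E) := by
  have hiter : ∀ p, T^[p] ⁻¹' E =ᵐ[m] E := by
    intro p
    induction p with
    | zero => rfl
    | succ p ih =>
      rw [Function.iterate_succ, Set.preimage_comp]
      exact (hT.quasiMeasurePreserving.preimage_ae_eq ih).trans hTE
  have h1 : ∀ p, ∫ z in E, (T^[p] ⁻¹' G).indicator (fun _ => (1 : ℝ)) z ∂m = m.real (G ∩ E) := by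
    intro p
    have hGp := (hT.iterate p).measurable hG
    rw [integral_indicator_const _ hGp, smul_eq_mul, mul_one, measureReal_restrict_apply hGp,
      ← (hT.iterate p).measureReal_preimage (hG.inter hE).nullMeasurableSet, Set.preimage_inter]
    exact measureReal_congr ((ae_eq_refl _).inter (hiter p).symm)
  have hint : ∀ p, Integrable ((T^[p] ⁻¹' G).indicator fun _ => (1 : ℝ)) (m.restrict E) :=
    fun p => (integrable_const _).indicator ((hT.iterate p).measurable hG)
  -- Integrate over `E` the number of visits to `G` during the first `W` steps; each time
  -- contributes the measure of `G ∩ E`.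
  calc L * m.real E = ∫ z in E, (L : ℝ) ∂m := by rw [setIntegral_const, smul_eq_mul, mul_comm]
    _ ≤ ∫ z in E, ∑ p ∈ Finset.range W, (T^[p] ⁻¹' G).indicator (fun _ => (1 : ℝ)) z ∂m := by
        refine integral_mono (integrable_const _) (integrable_finsetSum _ fun p _ => hint p) ?_
        intro z
        obtain ⟨c, hc, hc'⟩ := hcard z
        change (L : ℝ) ≤ ∑ p ∈ Finset.range W, (T^[p] ⁻¹' G).indicator (fun _ => (1 : ℝ)) z
        calc (L : ℝ) = ∑ p ∈ Finset.Ico c (c + L),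
              (T^[p] ⁻¹' G).indicator (fun _ => (1 : ℝ)) z := by
              rw [Finset.sum_congr rfl (g := fun _ => (1 : ℝ))]
              · simp
              · intro p hp
                obtain ⟨hp1, hp2⟩ := Finset.mem_Ico.1 hp
                have := hc' (p - c) (by omega)
                rw [Nat.add_sub_cancel' hp1] at this
                exact Set.indicator_of_mem (s := T^[p] ⁻¹' G) this _
          _ ≤ _ := by
              refine Finset.sum_le_sum_of_subset_of_nonneg ?_ fun p _ _ =>
                Set.indicator_nonneg (fun _ _ => zero_le_one) _
              intro p hp
              have := Finset.mem_Ico.1 hp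
              exact Finset.mem_range.2 (by omega)
    _ = W * m.real (G ∩ E) := by
        rw [integral_finsetSum _ fun p _ => hint p, Finset.sum_congr rfl fun p _ => h1 p]
        simp

/-- If almost invariant sets `G n κ`, on which some power of `T` acts like `R κ`, meet every orbit
with positive density, then the space is covered by invariant sets `D κ` such that the restriction
of `m` to every invariant subset of `D κ` is `R κ`-invariant. -/
theorem exists_invariant_cover [IsProbabilityMeasure m] (hT : MeasurePreserving T m m)
    {ι : Type*} [Countable ι] {C : ι → Set α} (hC : ∀ i, MeasurableSet (C i))
    {K : Type*} [Finite K] {R : K → α → α} (hR : ∀ κ, Measurable (R κ))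
    {G : ℕ → K → Set α} (hG : ∀ n κ, MeasurableSet (G n κ))
    (hTG : ∀ κ, Tendsto (fun n => m.real ((T ⁻¹' G n κ) ∆ G n κ)) atTop (𝓝 0)) {q : ℕ → K → ℕ}
    (hq : ∀ κ i, ∀ᶠ n in atTop, G n κ ∩ T^[q n κ] ⁻¹' C i = G n κ ∩ R κ ⁻¹' C i) {B : ℕ}
    (hcard : ∀ n, ∃ L W, 0 < L ∧ W ≤ B * L ∧
      ∀ z, ∃ c, c + L ≤ W ∧ ∀ i < L, T^[c + i] z ∈ ⋃ κ, G n κ) :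
    ∃ D : K → Set α, (∀ κ, MeasurableSet (D κ)) ∧ (∀ κ, T ⁻¹' D κ =ᵐ[m] D κ) ∧
      (⋃ κ, D κ) =ᵐ[m] Set.univ ∧
      ∀ κ E, MeasurableSet E → T ⁻¹' E =ᵐ[m] E → E ⊆ D κ →
        ∀ i, m.real (E ∩ R κ ⁻¹' C i) = m.real (E ∩ C i) := by
  choose ψ hψ using fun i => exists_isInvariantDensity hT (hC i)
  choose ψ' hψ' using fun κ i => exists_isInvariantDensity hT (hR κ (hC i))
  have hmeas : ∀ κ i, MeasurableSet {z | ψ i z ≠ ψ' κ i z} := fun κ i =>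
    (measurableSet_eq_fun (hψ i).measurable (hψ' κ i).measurable).compl
  have hsmall : ∀ κ, Tendsto (fun n => m.real (G n κ ∩ ⋃ i, {z | ψ i z ≠ ψ' κ i z})) atTop
      (𝓝 0) := fun κ =>
    tendsto_measureReal_inter_iUnion (hmeas κ) fun i =>
      (hψ i).tendsto_inter_ne (hψ' κ i) (fun n => hG n κ) (hTG κ) (q' := fun _ => 0) (hq κ i)
  -- On `D κ` the set `C i` and its preimage under `R κ` have equal densities for all i. By
  -- `hsmall`, the sets `G n κ` asymptotically avoid the complement.
  set D : K → Set α := fun κ => (⋃ i, {z | ψ i z ≠ ψ' κ i z})ᶜ with hD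
  have hDm : ∀ κ, MeasurableSet (D κ) := fun κ => (MeasurableSet.iUnion (hmeas κ)).compl
  have hDmem : ∀ κ z, z ∈ D κ ↔ ∀ i, ψ i z = ψ' κ i z := fun κ z => by simp [hD]
  have hDT : ∀ κ, T ⁻¹' D κ =ᵐ[m] D κ := by
    intro κ
    have h1 := ae_all_iff.2 fun i => (hψ i).comp_ae_eq
    have h2 := ae_all_iff.2 fun i => (hψ' κ i).comp_ae_eq
    filter_upwards [h1, h2] with z hz hz'
    refine propext ?_
    change T z ∈ D κ ↔ z ∈ D κ
    simp only [Function.comp_apply] at hz hz'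
    rw [hDmem, hDmem]
    simp only [hz, hz']
  refine ⟨D, hDm, hDT, ?_, ?_⟩
  · cases nonempty_fintype K
    -- The union of the `G n κ` occupies at least the proportion 1/B of this invariant set, yet
    -- asymptotically misses it, so it is null.
    set E := (⋃ κ, D κ)ᶜ with hE
    have hEm : MeasurableSet E := (MeasurableSet.iUnion hDm).compl
    have hTE : T ⁻¹' E =ᵐ[m] E := by
      rw [hE, Set.preimage_compl, Set.preimage_iUnion]
      exact (Filter.EventuallyEq.countable_iUnion hDT).compl
    have hGE : ∀ n, m.real ((⋃ κ, G n κ) ∩ E)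
        ≤ ∑ κ, m.real (G n κ ∩ ⋃ i, {z | ψ i z ≠ ψ' κ i z}) := by
      intro n
      rw [Set.iUnion_inter]
      refine (measureReal_iUnion_fintype_le _).trans (Finset.sum_le_sum fun κ _ => ?_)
      refine measureReal_mono (Set.inter_subset_inter_right _ fun z hz => ?_)
      by_contra h
      exact hz (Set.mem_iUnion.2 ⟨κ, h⟩)
    have hle : ∀ n, m.real E ≤ B * ∑ κ, m.real (G n κ ∩ ⋃ i, {z | ψ i z ≠ ψ' κ i z}) := by
      intro n
      obtain ⟨L, W, hL, hW, hc⟩ := hcard n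
      have h1 := mul_measureReal_le_of_card hT (MeasurableSet.iUnion (hG n)) hc hEm hTE
      have hL' : (0 : ℝ) < L := by exact_mod_cast hL
      have hW' : (W : ℝ) ≤ B * L := by exact_mod_cast hW
      refine le_of_mul_le_mul_left ?_ hL'
      calc L * m.real E ≤ W * m.real ((⋃ κ, G n κ) ∩ E) := h1
        _ ≤ (B * L) * ∑ κ, m.real (G n κ ∩ ⋃ i, {z | ψ i z ≠ ψ' κ i z}) :=
            mul_le_mul hW' (hGE n) measureReal_nonneg (by positivity)
        _ = _ := by ring
    have hlim : Tendsto (fun n => (B : ℝ) * ∑ κ, m.real (G n κ ∩ ⋃ i, {z | ψ i z ≠ ψ' κ i z}))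
        atTop (𝓝 0) := by
      simpa using (tendsto_finsetSum Finset.univ fun κ _ => hsmall κ).const_mul (B : ℝ)
    have h0 : m.real E = 0 :=
      le_antisymm (ge_of_tendsto' hlim hle) measureReal_nonneg
    rw [measureReal_eq_zero_iff] at h0
    rw [ae_eq_univ]
    exact h0
  · intro κ E hE hTE hED i
    rw [(hψ i).measureReal_inter_eq hE hTE, (hψ' κ i).measureReal_inter_eq hE hTE]
    exact setIntegral_congr_fun hE fun z hz => ((hDmem κ z).1 (hED hz) i).symm

/-- To identify `m` with `ρ` it suffices to do so on the members of a finite invariant cover. -/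
theorem eq_of_invariant_cover [IsProbabilityMeasure m] {ρ : Measure α}
    {K : Type*} [Finite K] {D : K → Set α} (hD : ∀ κ, MeasurableSet (D κ))
    (hDT : ∀ κ, T ⁻¹' D κ =ᵐ[m] D κ) (hcover : (⋃ κ, D κ) =ᵐ[m] Set.univ)
    (hρ : ∀ κ E, MeasurableSet E → T ⁻¹' E =ᵐ[m] E → E ⊆ D κ → m.restrict E = m E • ρ) :
    m = ρ := by
  classical
  cases nonempty_fintype K
  -- The sets `D κ` may overlap, so the cover is made disjoint by splitting off one member at a
  -- time.
  have key : ∀ s : Finset K, ∀ E, MeasurableSet E → T ⁻¹' E =ᵐ[m] E → E ⊆ ⋃ κ ∈ s, D κ →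
      m.restrict E = m E • ρ := by
    intro s
    induction s using Finset.induction_on with
    | empty =>
      intro E _ _ hE
      obtain rfl : E = ∅ := by simpa using hE
      simp
    | insert κ s _ ih =>
      intro E hE hTE hsub
      have h1 := hρ κ (E ∩ D κ) (hE.inter (hD κ)) (hTE.inter (hDT κ)) Set.inter_subset_right
      have h2 := ih (E \ D κ) (hE.diff (hD κ)) (hTE.diff (hDT κ)) (by
        rintro z ⟨hz, hz'⟩
        have := hsub hz
        simp only [Set.mem_iUnion, Finset.mem_insert] at this ⊢
        obtain ⟨κ', rfl | h, h'⟩ := this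
        · exact absurd h' hz'
        · exact ⟨κ', h, h'⟩)
      rw [← Measure.restrict_inter_add_sdiff E (hD κ), h1, h2, ← add_smul, measure_inter_add_sdiff E (hD κ)]
  have h := key Finset.univ (⋃ κ, D κ) (MeasurableSet.iUnion hD)
    (by rw [Set.preimage_iUnion]; exact Filter.EventuallyEq.countable_iUnion hDT) (by simp)
  rwa [Measure.restrict_congr_set hcover, Measure.restrict_univ, measure_congr hcover,
    measure_univ, one_smul] at h

end AbstractErgodic

/-! ### Recognising multiples of the product measure. -/

section Product

variable {α β : Type*} [MeasurableSpace α] [MeasurableSpace β]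

/-- A finite measure with ergodic marginals (up to scaling) that is invariant under an
ergodic transformation of the second coordinate is a multiple of the product measure. -/
theorem eq_smul_prod_of_measurePreserving_snd {μ : Measure α} {ν : Measure β}
    [IsProbabilityMeasure μ] [IsProbabilityMeasure ν] {f : α → α} {g g' : β → β}
    (hf : Ergodic f μ) (hg' : Ergodic g' ν) {ρ : Measure (α × β)} [IsFiniteMeasure ρ]
    (hρ : MeasurePreserving (Prod.map f g) ρ ρ) (hρ' : MeasurePreserving (Prod.map id g') ρ ρ)
    (h1 : ρ.map Prod.fst ≪ μ) (h2 : ρ.map Prod.snd ≪ ν) : ρ = ρ Set.univ • μ.prod ν := by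
  have hfst : MeasurePreserving f (ρ.map Prod.fst) (ρ.map Prod.fst) := by
    refine ⟨hf.measurable, ?_⟩
    rw [Measure.map_map hf.measurable measurable_fst]
    conv_rhs => rw [← hρ.map_eq, Measure.map_map measurable_fst hρ.measurable]
    rfl
  obtain ⟨c, hc⟩ := hf.eq_smul_of_absolutelyContinuous hfst h1
  have hcu : ρ Set.univ = c := by
    have := congrArg (fun κ => κ Set.univ) hc
    simpa [Measure.map_apply measurable_fst MeasurableSet.univ] using this
  rw [hcu]
  have hrect : ∀ A B, MeasurableSet A → MeasurableSet B → ρ (A ×ˢ B) = c * (μ A * ν B) := by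
    intro A B hA hB
    -- The slice over `A` is invariant under the ergodic map `g'` and absolutely continuous, hence a
    -- multiple of ν; its mass is fixed by the first marginal.
    set κ := (ρ.restrict (Prod.fst ⁻¹' A)).map Prod.snd with hκ
    have hAm : MeasurableSet (Prod.fst ⁻¹' A : Set (α × β)) := measurable_fst hA
    have hκap : ∀ B, MeasurableSet B → κ B = ρ (A ×ˢ B) := fun B hB => by
      rw [hκ, Measure.map_apply measurable_snd hB, Measure.restrict_apply (measurable_snd hB),
        Set.inter_comm]
      rfl
    have hκinv : MeasurePreserving g' κ κ := by
      refine ⟨hg'.measurable, Measure.ext fun B hB => ?_⟩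
      rw [Measure.map_apply hg'.measurable hB, hκap _ (hg'.measurable hB), hκap _ hB,
        ← hρ'.measure_preimage (hA.prod hB).nullMeasurableSet]
      rfl
    have hκν : κ ≪ ν :=
      (Measure.AbsolutelyContinuous.map Measure.restrict_le_self.absolutelyContinuous
        measurable_snd).trans h2
    obtain ⟨d, hd⟩ := hg'.eq_smul_of_absolutelyContinuous hκinv hκν
    have hdA : d = c * μ A := by
      have e1 : κ Set.univ = d := by rw [hd]; simp
      have e2 : κ Set.univ = c * μ A := by
        rw [hκap _ MeasurableSet.univ, ← Set.univ_inter A, ← smul_eq_mul, ← Measure.smul_apply,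
          ← hc, Measure.map_apply measurable_fst (by simpa using hA)]
        congr 1
        ext z
        simp
      rw [← e1, e2]
    rw [← hκap B hB, hd, Measure.smul_apply, smul_eq_mul, hdA, mul_assoc]
  have hcfin : c ≠ ⊤ := hcu ▸ measure_ne_top ρ _
  refine ext_of_generate_finite _ generateFrom_prod.symm isPiSystem_prod ?_ ?_
  · rintro _ ⟨A, hA, B, hB, rfl⟩
    rw [hrect A B hA hB, Measure.smul_apply, Measure.prod_prod, smul_eq_mul]
  · simp [hcu]

theorem eq_smul_prod_of_measurePreserving_fst {μ : Measure α} {ν : Measure β}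
    [IsProbabilityMeasure μ] [IsProbabilityMeasure ν] {f f' : α → α} {g : β → β}
    (hfm : Measurable f) (hf' : Ergodic f' μ) (hg : Ergodic g ν) {ρ : Measure (α × β)} [IsFiniteMeasure ρ]
    (hρ : MeasurePreserving (Prod.map f g) ρ ρ) (hρ' : MeasurePreserving (Prod.map f' id) ρ ρ)
    (h1 : ρ.map Prod.fst ≪ μ) (h2 : ρ.map Prod.snd ≪ ν) : ρ = ρ Set.univ • μ.prod ν := by
  have hswap : MeasurePreserving (Prod.swap : α × β → β × α) ρ (ρ.map Prod.swap) :=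
    ⟨measurable_swap, rfl⟩
  have hconj : ∀ {F : α × β → α × β} {F' : β × α → β × α}, MeasurePreserving F ρ ρ →
      Measurable F' → F' ∘ Prod.swap = Prod.swap ∘ F →
      MeasurePreserving F' (ρ.map Prod.swap) (ρ.map Prod.swap) := by
    intro F F' hF hF' h
    refine ⟨hF', ?_⟩
    rw [Measure.map_map hF' measurable_swap, h, ← Measure.map_map measurable_swap hF.measurable,
      hF.map_eq]
  have : IsFiniteMeasure (ρ.map Prod.swap) := inferInstance
  have h := eq_smul_prod_of_measurePreserving_snd hg hf' (ρ := ρ.map Prod.swap)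
    (hconj hρ (F' := Prod.map g f) (hg.measurable.prodMap hfm) rfl)
    (hconj hρ' (F' := Prod.map id f') (measurable_id.prodMap hf'.measurable) rfl)
    (by rwa [Measure.map_map measurable_fst measurable_swap])
    (by rwa [Measure.map_map measurable_snd measurable_swap])
  have h' := congrArg (Measure.map Prod.swap) h
  rw [Measure.map_map measurable_swap measurable_swap, Prod.swap_swap_eq, Measure.map_id,
    Measure.map_smul, Measure.prod_swap, Measure.map_apply measurable_swap MeasurableSet.univ,
    Set.preimage_univ] at h'
  exact h'

end Product

/-! ### Unique ergodicity of bounded rank-one systems. -/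

/-- The sum over a window of the infinite word of a function `Φ` of position that only depends on
the next `k` letters is proportional to the length of the window, up to a small error. -/
theorem IsParams.abs_sum_window_sub_le {r : ℕ → ℕ} {s : ℕ → List ℕ} (hs : IsParams r s) {S : ℕ}
    (hS : ∀ n, ∀ a ∈ s n, a ≤ S) {Φ : ℕ → ℝ} (h0 : ∀ i, 0 ≤ Φ i) (h1 : ∀ i, Φ i ≤ 1) {k : ℕ}
    (hloc : ∀ i i', (∀ j < k, infWord s (i + j) = infWord s (i' + j)) → Φ i = Φ i') (n : ℕ) :
    ∃ c K : ℝ, ∀ b N : ℕ, |∑ j ∈ Finset.range N, Φ (b + j) - N * c|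
      ≤ K + N * ((k + S) / (word s n).length) := by
  set h := (word s n).length with hh
  have hpos : 0 < h := by have := hs.lt_length_word n; omega
  have hposR : (0 : ℝ) < h := by exact_mod_cast hpos
  set c := (∑ i ∈ Finset.range h, Φ i) / h with hc
  have hc0 : 0 ≤ c := div_nonneg (Finset.sum_nonneg fun i _ => h0 i) hposR.le
  have hc1 : c ≤ 1 := by
    rw [hc, div_le_one hposR]
    calc ∑ i ∈ Finset.range h, Φ i ≤ ∑ i ∈ Finset.range h, (1 : ℝ) :=
          Finset.sum_le_sum fun i _ => h1 i
      _ = h := by simp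
  have hΨ : ∀ i, |Φ i - c| ≤ 1 := fun i => abs_le.2 ⟨by linarith [h0 i], by linarith [h1 i]⟩
  set Q : ℕ → ℝ := fun b => ∑ i ∈ Finset.range b, (Φ i - c) with hQ
  have hQadd : ∀ b N, Q (b + N) - Q b = ∑ i ∈ Finset.range N, (Φ (b + i) - c) := fun b N => by
    simp only [hQ, Finset.sum_range_add]
    ring
  have hQle : ∀ b N, |Q (b + N) - Q b| ≤ N := fun b N => by
    rw [hQadd]
    refine (Finset.abs_sum_le_sum_abs _ _).trans ?_
    calc _ ≤ ∑ i ∈ Finset.range N, (1 : ℝ) := Finset.sum_le_sum fun i _ => hΨ _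
      _ = N := by simp
  -- `c` is the mean of Φ over the initial block. In another block only the last positions, whose k
  -- letters reach past its end, can differ (error k), and the gap after it adds at most S.
  have hblock : ∀ j, |Q (pos s n (j + 1)) - Q (pos s n j)| ≤ k + S := by
    intro j
    have e1 : |Q (pos s n j + h) - Q (pos s n j)| ≤ k := by
      have e2 : ∑ i ∈ Finset.range h, (Φ i - c) = 0 := by
        rw [Finset.sum_sub_distrib, Finset.sum_const, Finset.card_range, nsmul_eq_mul, hc]
        field_simp
        simp
      rw [hQadd, ← sub_zero (∑ i ∈ Finset.range h, _), ← e2, ← Finset.sum_sub_distrib]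
      refine (Finset.abs_sum_le_sum_abs _ _).trans ?_
      calc _ ≤ ∑ i ∈ Finset.range h, if h < i + k then (1 : ℝ) else 0 := by
            refine Finset.sum_le_sum fun i hi => ?_
            split_ifs with hik
            · rw [abs_le]
              constructor <;> linarith [h0 i, h1 i, h0 (pos s n j + i), h1 (pos s n j + i)]
            · have : Φ (pos s n j + i) = Φ i := hloc _ _ fun j' hj' => by
                rw [add_assoc]
                exact hs.infWord_pos_add n j _ (by omega)
              rw [this]
              simp
        _ ≤ k := by
            rw [Finset.sum_ite, Finset.sum_const_zero, add_zero, Finset.sum_const, nsmul_eq_mul,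
              mul_one]
            have : (Finset.range h).filter (fun i => h < i + k) ⊆ Finset.Ico (h - k) h := by
              intro i hi
              simp only [Finset.mem_filter, Finset.mem_range, Finset.mem_Ico] at hi ⊢
              omega
            have := Finset.card_le_card this
            rw [Nat.card_Ico] at this
            exact_mod_cast this.trans (by omega)
    have e3 := hQle (pos s n j + h) (gap s n j)
    have e4 : (gap s n j : ℝ) ≤ S := by exact_mod_cast gap_le hS n j
    rw [pos_succ, ← add_assoc]
    refine (abs_sub_le _ (Q (pos s n j + h)) _).trans ?_
    linarith
  have hblocks : ∀ j i, |Q (pos s n (j + i)) - Q (pos s n j)| ≤ i * (k + S) := by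
    intro j i
    induction i with
    | zero => simp
    | succ i ih =>
      refine (abs_sub_le _ (Q (pos s n (j + i))) _).trans ?_
      have := hblock (j + i)
      rw [← add_assoc]
      push_cast
      linarith
  have hposle : ∀ j i, pos s n j + i * h ≤ pos s n (j + i) := by
    intro j i
    induction i with
    | zero => simp
    | succ i ih =>
      rw [← add_assoc, pos_succ, add_mul]
      omega
  have hnear : ∀ b j, pos s n j ≤ b → b < pos s n (j + 1) →
      |Q b - Q (pos s n j)| ≤ h + S := by
    intro b j hj hj'
    obtain ⟨e, rfl⟩ := Nat.exists_eq_add_of_le hj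
    refine (hQle _ e).trans ?_
    rw [pos_succ] at hj'
    have := gap_le hS n j
    exact_mod_cast (by omega : e ≤ h + S)
  -- The two ends of the window cost `h + S` each; the last term arises because the number of blocks
  -- is bounded by (N+h+S)/h rather than N/h.
  refine ⟨c, 2 * (h + S) + (h + S) * ((k + S) / h), fun b N => ?_⟩
  have hsum : ∑ j ∈ Finset.range N, Φ (b + j) - N * c = Q (b + N) - Q b := by
    rw [hQadd, Finset.sum_sub_distrib]
    simp
  rw [hsum]
  obtain ⟨j, hj, hj'⟩ := hs.exists_pos_le_lt n b
  obtain ⟨l, hl, hl'⟩ := hs.exists_pos_le_lt n (b + N)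
  have hjl : j ≤ l := by
    by_contra hlt
    have : pos s n (l + 1) ≤ pos s n j :=
      Finset.sum_le_sum_of_subset (Finset.range_mono (by omega))
    omega
  obtain ⟨i, rfl⟩ := Nat.exists_eq_add_of_le hjl
  have hi : i * h ≤ N + h + S := by
    have e1 := hposle j i
    have e2 := gap_le hS n j
    rw [pos_succ] at hj'
    omega
  have hi' : (i : ℝ) ≤ (N + h + S) / h := by
    rw [le_div_iff₀ hposR]
    exact_mod_cast hi
  have e1 := hnear b j hj hj'
  have e2 := hnear (b + N) (j + i) hl hl'
  have e3 := hblocks j i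
  have e4 : (i : ℝ) * (k + S) ≤ (N + h + S) / h * (k + S) := by gcongr
  have e5 : ((N : ℝ) + h + S) / h * (k + S)
      = N * ((k + S) / h) + (h + S) * ((k + S) / h) := by ring
  rw [abs_le] at e1 e2 e3 ⊢
  constructor <;> linarith [e1.1, e1.2, e2.1, e2.2, e3.1, e3.2]

/-- Cylinder sets of the symbolic system. -/
def cyl (s : ℕ → List ℕ) (i : Σ F : Finset ℤ, Set (F → Fin 2)) : Set (system s) :=
  Subtype.val ⁻¹' cylinder i.1 i.2

theorem mem_cyl_congr {s : ℕ → List ℕ} (i : Σ F : Finset ℤ, Set (F → Fin 2)) {x x' : system s}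
    (h : ∀ j ∈ i.1, x.1 j = x'.1 j) : x ∈ cyl s i ↔ x' ∈ cyl s i := by
  have : i.1.restrict x.1 = i.1.restrict x'.1 := funext fun j => h j j.2
  simp [cyl, this]

theorem range_cyl (s : ℕ → List ℕ) :
    Set.range (cyl s) = Set.preimage Subtype.val '' measurableCylinders fun _ : ℤ => Fin 2 := by
  ext A
  simp only [Set.mem_range, Set.mem_image, mem_measurableCylinders]
  constructor
  · rintro ⟨⟨F, B⟩, rfl⟩
    exact ⟨_, ⟨F, B, B.toFinite.measurableSet, rfl⟩, rfl⟩
  · rintro ⟨_, ⟨F, B, _, rfl⟩, rfl⟩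
    exact ⟨⟨F, B⟩, rfl⟩

theorem isPiSystem_range_cyl (s : ℕ → List ℕ) : IsPiSystem (Set.range (cyl s)) := by
  rw [range_cyl]
  exact (isPiSystem_measurableCylinders (α := fun _ : ℤ => Fin 2)).comap Subtype.val

theorem generateFrom_range_cyl (s : ℕ → List ℕ) :
    MeasurableSpace.generateFrom (Set.range (cyl s))
      = (inferInstance : MeasurableSpace (system s)) := by
  rw [range_cyl, ← MeasurableSpace.comap_generateFrom, generateFrom_measurableCylinders]
  rfl

theorem measurableSet_cyl (s : ℕ → List ℕ) (i : Σ F : Finset ℤ, Set (F → Fin 2)) :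
    MeasurableSet (cyl s i) :=
  measurable_subtype_coe (MeasurableSet.cylinder i.1 i.2.toFinite.measurableSet)

theorem systemShift_iterate_apply {s : ℕ → List ℕ} (p : ℕ) (x : system s) (j : ℤ) :
    ((systemShift s)^[p] x).1 j = x.1 (j + p) := by
  induction p generalizing x with
  | zero => simp
  | succ p ih =>
    rw [Function.iterate_succ_apply, ih]
    change x.1 (j + p + 1) = _
    push_cast
    ring_nf

theorem measurable_systemShift (s : ℕ → List ℕ) : Measurable (systemShift s) := by
  refine Measurable.subtype_mk (measurable_pi_lambda _ fun i => ?_)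
  exact (measurable_pi_apply (i + 1)).comp measurable_subtype_coe

/-- The frequencies of a cylinder set along orbits. -/
theorem IsParams.abs_sum_indicator_cyl_le {r : ℕ → ℕ} {s : ℕ → List ℕ} (hs : IsParams r s) {S : ℕ}
    (hS : ∀ n, ∀ a ∈ s n, a ≤ S) (i : Σ F : Finset ℤ, Set (F → Fin 2)) :
    ∃ k : ℕ, ∀ n, ∃ c K : ℝ, ∀ N : ℕ, ∀ x : system s,
      |∑ j ∈ Finset.range N, (cyl s i).indicator (fun _ => (1 : ℝ)) ((systemShift s)^[j] x) - N * c|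
        ≤ K + N * ((k + S) / (word s n).length) := by
  obtain ⟨F, B⟩ := i
  obtain ⟨M, hM⟩ : ∃ M : ℕ, ∀ j ∈ F, j.natAbs ≤ M :=
    ⟨F.sup Int.natAbs, fun j hj => Finset.le_sup (f := Int.natAbs) hj⟩
  classical
  set Φ : ℕ → ℝ := fun b =>
    if (fun j : F => infWord s (b + ((j : ℤ) + M).toNat)) ∈ B then 1 else 0 with hΦ
  refine ⟨2 * M + 1, fun n => ?_⟩
  obtain ⟨c, K, hcK⟩ := hs.abs_sum_window_sub_le hS (Φ := Φ) (k := 2 * M + 1)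
    (fun b => by simp only [hΦ]; split_ifs <;> norm_num)
    (fun b => by simp only [hΦ]; split_ifs <;> norm_num)
    (fun b b' h => by
      simp only [hΦ]
      have : (fun j : F => infWord s (b + ((j : ℤ) + M).toNat))
          = fun j : F => infWord s (b' + ((j : ℤ) + M).toNat) :=
        funext fun j => h _ (by have := hM j j.2; omega)
      rw [this]) n
  refine ⟨c, K, fun N x => ?_⟩
  -- The coordinates of `F` lie in [-M, M], so the first N shifts of x see only this window; Φ reads
  -- 2M+1 letters, with coordinate 0 at offset M.
  obtain ⟨b, hb⟩ := x.2 (-M) (N + 2 * M + 1)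
  refine le_trans (le_of_eq ?_) (hcK b N)
  congr 2
  refine Finset.sum_congr rfl fun j hj => ?_
  have hj := Finset.mem_range.1 hj
  have hw : F.restrict ((systemShift s)^[j] x).1
      = fun j' : F => infWord s (b + j + ((j' : ℤ) + M).toNat) := by
    funext j'
    have h1 := hM j' j'.2
    have h2 := hb (j + ((j' : ℤ) + M).toNat) (by omega)
    change ((systemShift s)^[j] x).1 j' = _
    rw [systemShift_iterate_apply, add_assoc]
    exact (congrArg x.1 (by omega)).trans h2
  simp only [hΦ, Set.indicator_apply, cyl, Set.mem_preimage, mem_cylinder, hw]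

/-- Cylinder frequencies along orbits are uniform with constants independent of the point, so
integrating gives the same approximation for every invariant probability measure. Letting N and then
n grow determines the measure on cylinders. -/
theorem IsParams.eq_of_isSystemMeasure {r : ℕ → ℕ} {s : ℕ → List ℕ} (hs : IsParams r s) {S : ℕ}
    (hS : ∀ n, ∀ a ∈ s n, a ≤ S) {μ μ' : Measure (system s)} (hμ : IsSystemMeasure s μ)
    (hμ' : IsSystemMeasure s μ') : μ = μ' := by
  have := hμ.isProbabilityMeasure
  have := hμ'.isProbabilityMeasure
  refine ext_of_generate_finite _ (generateFrom_range_cyl s).symm (isPiSystem_range_cyl s) ?_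
    (by simp)
  rintro _ ⟨i, rfl⟩
  obtain ⟨k, hk⟩ := hs.abs_sum_indicator_cyl_le hS i
  have hC := measurableSet_cyl s i
  have key : ∀ n, ∃ c K : ℝ, ∀ ρ : Measure (system s), IsSystemMeasure s ρ → ∀ N : ℕ,
      |N * ρ.real (cyl s i) - N * c| ≤ K + N * ((k + S) / (word s n).length) := by
    intro n
    obtain ⟨c, K, hcK⟩ := hk n
    refine ⟨c, K, fun ρ hρ N => ?_⟩
    have := hρ.isProbabilityMeasure
    have hint : ∀ j, Integrable (fun x => (cyl s i).indicator (fun _ => (1 : ℝ))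
        ((systemShift s)^[j] x)) ρ := fun j =>
      (hρ.invariant.iterate j).integrable_comp_of_integrable
        ((integrable_const (1 : ℝ)).indicator hC)
    have h1 : N * ρ.real (cyl s i) - N * c
        = ∫ x, (∑ j ∈ Finset.range N, (cyl s i).indicator (fun _ => (1 : ℝ))
          ((systemShift s)^[j] x) - N * c) ∂ρ := by
      rw [integral_sub (integrable_finsetSum _ fun j _ => hint j) (integrable_const _),
        integral_finsetSum _ fun j _ => hint j]
      have : ∀ j, ∫ x, (cyl s i).indicator (fun _ => (1 : ℝ)) ((systemShift s)^[j] x) ∂ρ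
          = ρ.real (cyl s i) := by
        intro j
        have e := (hρ.invariant.iterate j).measureReal_preimage hC.nullMeasurableSet
        rw [← e, ← integral_indicator_one ((hρ.invariant.iterate j).measurable hC)]
        rfl
      simp [this]
    rw [h1, ← Real.norm_eq_abs]
    refine (norm_integral_le_of_norm_le_const (C := K + N * ((k + S) / (word s n).length))
      (Filter.Eventually.of_forall fun x => hcK N x)).trans (le_of_eq ?_)
    simp
  have hzero : |μ.real (cyl s i) - μ'.real (cyl s i)| = 0 := by
    refine le_antisymm ?_ (abs_nonneg _)
    have h2 : ∀ n : ℕ, |μ.real (cyl s i) - μ'.real (cyl s i)|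
        ≤ 2 * ((k + S) / (word s n).length) := by
      intro n
      obtain ⟨c, K, hcK⟩ := key n
      by_contra! hlt
      obtain ⟨N, hN⟩ := exists_nat_gt (2 * K / (|μ.real (cyl s i) - μ'.real (cyl s i)|
        - 2 * ((k + S) / (word s n).length)))
      rw [div_lt_iff₀ (by linarith)] at hN
      have e1 := hcK μ hμ N
      have e2 := hcK μ' hμ' N
      have e3 : N * |μ.real (cyl s i) - μ'.real (cyl s i)|
          = |(N * μ.real (cyl s i) - N * c) - (N * μ'.real (cyl s i) - N * c)| := by
        rw [sub_sub_sub_cancel_right, ← mul_sub, abs_mul, Nat.abs_cast]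
      have e4 := abs_sub (N * μ.real (cyl s i) - N * c) (N * μ'.real (cyl s i) - N * c)
      rw [← e3] at e4
      nlinarith
    refine le_of_forall_pos_le_add fun ε hε => ?_
    obtain ⟨n, hn⟩ := exists_nat_gt (2 * (k + S) / ε)
    refine (h2 n).trans ?_
    rw [div_lt_iff₀ hε] at hn
    have hl : (n : ℝ) < (word s n).length := by exact_mod_cast hs.lt_length_word n
    have hn0 : (0 : ℝ) ≤ n := Nat.cast_nonneg n
    rw [zero_add, ← mul_div_assoc, div_le_iff₀ (by linarith)]
    nlinarith
  rw [abs_eq_zero, sub_eq_zero] at hzero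
  exact (measureReal_eq_measureReal_iff).1 hzero

/-- The only invariant probability measure is an extreme point of the set of all of them. -/
theorem IsParams.ergodic_systemShift {r : ℕ → ℕ} {s : ℕ → List ℕ} (hs : IsParams r s) {S : ℕ}
    (hS : ∀ n, ∀ a ∈ s n, a ≤ S) {μ : Measure (system s)} (hμ : IsSystemMeasure s μ) :
    Ergodic (systemShift s) μ := by
  refine Ergodic.of_mem_extremePoints ⟨⟨hμ.invariant, hμ.isProbabilityMeasure⟩, ?_⟩
  rintro μ₁ ⟨h1, h1'⟩ μ₂ ⟨h2, h2'⟩ _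
  exact hs.eq_of_isSystemMeasure hS ⟨h1', h1⟩ hμ

/-! ### Pairs of locally periodic points. -/

/-- An exit from `G` admits no return within `L` steps, so the preimages of the exit set at times 0,
…, L are disjoint and it has measure at most 1/(L+1). Entrances have the same measure by invariance.
-/
theorem measureReal_preimage_symmDiff_le {α : Type*} [MeasurableSpace α] {m : Measure α}
    [IsProbabilityMeasure m] {T : α → α} (hT : MeasurePreserving T m m) {G : Set α}
    (hG : MeasurableSet G) {L : ℕ}
    (hL : ∀ z ∈ G, T z ∉ G → ∀ j, 1 ≤ j → j ≤ L → T^[j] z ∉ G) :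
    m.real ((T ⁻¹' G) ∆ G) ≤ 2 / ((L : ℝ) + 1) := by
  have hTG := hT.measurable hG
  set B := G \ T ⁻¹' G with hB
  have hBm : MeasurableSet B := hG.diff hTG
  have hdisj : ∀ p q, p < q → q ≤ L → Disjoint (T^[p] ⁻¹' B) (T^[q] ⁻¹' B) := by
    intro p q hpq hq
    rw [Set.disjoint_left]
    intro z hz hz'
    obtain ⟨d, rfl⟩ := Nat.exists_eq_add_of_lt hpq
    refine hL _ hz.1 hz.2 (d + 1) (by omega) (by omega) ?_
    rw [← Function.iterate_add_apply]
    have := hz'.1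
    rwa [show d + 1 + p = p + d + 1 by omega]
  have h1 : ((L : ℝ) + 1) * m.real B ≤ 1 := by
    have h2 := measureReal_biUnion_finset (μ := m) (s := Finset.range (L + 1))
      (f := fun p => T^[p] ⁻¹' B) (by
        intro p hp q hq hpq
        simp only [Finset.coe_range, Set.mem_Iio] at hp hq
        rcases lt_or_gt_of_ne hpq with h | h
        · exact hdisj p q h (by omega)
        · exact (hdisj q p h (by omega)).symm) fun p _ => (hT.iterate p).measurable hBm
    simp only [fun p => (hT.iterate p).measureReal_preimage hBm.nullMeasurableSet,
      Finset.sum_const, Finset.card_range, nsmul_eq_mul, Nat.cast_add, Nat.cast_one] at h2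
    rw [← h2]
    exact measureReal_le_one
  have h3 : m.real (T ⁻¹' G \ G) = m.real B := by
    have e1 := measureReal_inter_add_sdiff (μ := m) (s := T ⁻¹' G) hG
    have e2 := measureReal_inter_add_sdiff (μ := m) (s := G) hTG
    rw [hT.measureReal_preimage hG.nullMeasurableSet, Set.inter_comm] at e1
    linarith
  have h4 : m.real ((T ⁻¹' G) ∆ G) ≤ m.real B + m.real B := by
    refine (measureReal_union_le _ _).trans ?_
    exact add_le_add h3.le le_rfl
  rw [le_div_iff₀ (by positivity)]
  nlinarith [Nat.cast_nonneg (α := ℝ) L]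

theorem measurePreserving_of_comp {α : Type*} [MeasurableSpace α] {m : Measure α} {F H : α → α}
    (hF : MeasurePreserving F m m) (hH : Measurable H) (hHF : MeasurePreserving (H ∘ F) m m) :
    MeasurePreserving H m m := by
  refine ⟨hH, ?_⟩
  conv_lhs => rw [← hF.map_eq]
  rw [Measure.map_map hH hF.measurable, hHF.map_eq]

/-- The pairs of points that, around the origin, are periodic with periods `h + a` and `h + b`
respectively. -/
def periodicPairs (s t : ℕ → List ℕ) (h L a b : ℕ) : Set (system s × system t) :=
  {z | ∀ j : ℤ, |j| ≤ L → z.1.1 (j + h + a) = z.1.1 j ∧ z.2.1 (j + h + b) = z.2.1 j}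

theorem measurableSet_periodicPairs (s t : ℕ → List ℕ) (h L a b : ℕ) :
    MeasurableSet (periodicPairs s t h L a b) := by
  have h1 : ∀ i : ℤ, Measurable fun z : system s × system t => z.1.1 i := fun i =>
    (measurable_pi_apply i).comp (measurable_subtype_coe.comp measurable_fst)
  have h2 : ∀ i : ℤ, Measurable fun z : system s × system t => z.2.1 i := fun i =>
    (measurable_pi_apply i).comp (measurable_subtype_coe.comp measurable_snd)
  have : periodicPairs s t h L a b = ⋂ (j : ℤ) (_ : |j| ≤ L),
      {z | z.1.1 (j + h + a) = z.1.1 j} ∩ {z | z.2.1 (j + h + b) = z.2.1 j} := by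
    ext z
    simp [periodicPairs]
  rw [this]
  exact MeasurableSet.iInter fun j => MeasurableSet.iInter fun _ =>
    (measurableSet_eq_fun (h1 _) (h1 _)).inter (measurableSet_eq_fun (h2 _) (h2 _))

theorem mem_periodicPairs_iterate {s t : ℕ → List ℕ} {h L a b p : ℕ} {z : system s × system t} :
    (Prod.map (systemShift s) (systemShift t))^[p] z ∈ periodicPairs s t h L a b ↔
      ∀ j : ℤ, |j| ≤ L → z.1.1 (p + j + h + a) = z.1.1 (p + j) ∧
        z.2.1 (p + j + h + b) = z.2.1 (p + j) := by
  rw [Prod.map_iterate]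
  refine forall₂_congr fun j _ => ?_
  simp only [Prod.map_fst, Prod.map_snd, systemShift_iterate_apply]
  rw [show j + h + a + p = (p + j + h + a : ℤ) by ring,
    show j + h + b + p = (p + j + h + b : ℤ) by ring, add_comm j]

/-- Leaving means that periodicity fails at coordinate L+1, the only one new to the window. This
coordinate stays in the window for the next L steps. -/
theorem periodicPairs_exit {s t : ℕ → List ℕ} {h L a b : ℕ} {z : system s × system t}
    (hz : z ∈ periodicPairs s t h L a b)
    (hz' : Prod.map (systemShift s) (systemShift t) z ∉ periodicPairs s t h L a b) {p : ℕ}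
    (hp : 1 ≤ p) (hpL : p ≤ L) :
    (Prod.map (systemShift s) (systemShift t))^[p] z ∉ periodicPairs s t h L a b := by
  intro hzp
  refine hz' ((mem_periodicPairs_iterate (p := 1)).2 fun j hj => ?_)
  have h1 := mem_periodicPairs_iterate.1 hzp
  rw [abs_le] at hj
  rcases eq_or_lt_of_le hj.2 with h | h
  · have := h1 (1 + L - p) (abs_le.2 ⟨by omega, by omega⟩)
    rwa [show (p : ℤ) + (1 + L - p) = (1 : ℕ) + j by push_cast; omega] at this
  · exact hz _ (abs_le.2 ⟨by push_cast; omega, by push_cast; omega⟩)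

/-- On periodic pairs, the iterate `h + max a b` of the diagonal shift is a relative shift of the
two coordinates. -/
theorem periodicPairs_inter_preimage {s t : ℕ → List ℕ} {h L a b S M : ℕ} (ha : a ≤ S)
    (hb : b ≤ S) (hL : M + S ≤ L) {i j : Σ F : Finset ℤ, Set (F → Fin 2)}
    (hi : ∀ u ∈ i.1, u.natAbs ≤ M) (hj : ∀ u ∈ j.1, u.natAbs ≤ M) :
    periodicPairs s t h L a b ∩ (Prod.map (systemShift s) (systemShift t))^[h + max a b] ⁻¹'
        (cyl s i ×ˢ cyl t j)
      = periodicPairs s t h L a b ∩ Prod.map (systemShift s)^[b - a] (systemShift t)^[a - b] ⁻¹'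
        (cyl s i ×ˢ cyl t j) := by
  ext z
  refine and_congr_right fun hz => ?_
  rw [Prod.map_iterate]
  simp only [Set.mem_preimage, Set.mem_prod, Prod.map_fst, Prod.map_snd]
  refine and_congr (mem_cyl_congr i fun u hu => ?_) (mem_cyl_congr j fun u hu => ?_)
  · rw [systemShift_iterate_apply, systemShift_iterate_apply]
    have h1 := hi u hu
    -- With truncated subtraction, h + max a b = (h + a) + (b - a); the period h+a is removed and
    -- the shift by b-a remains.
    have h2 := (hz (u + (b - a : ℕ)) (abs_le.2 ⟨by omega, by omega⟩)).1
    exact (congrArg z.1.1 (by omega)).trans h2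
  · rw [systemShift_iterate_apply, systemShift_iterate_apply]
    have h1 := hj u hu
    have h2 := (hz (u + (a - b : ℕ)) (abs_le.2 ⟨by omega, by omega⟩)).2
    exact (congrArg z.2.1 (by omega)).trans h2

theorem exists_natAbs_le (F F' : Finset ℤ) :
    ∃ M : ℕ, (∀ u ∈ F, u.natAbs ≤ M) ∧ ∀ u ∈ F', u.natAbs ≤ M :=
  ⟨(F ∪ F').sup Int.natAbs,
    fun _ hu => Finset.le_sup (f := Int.natAbs) (Finset.mem_union_left _ hu),
    fun _ hu => Finset.le_sup (f := Int.natAbs) (Finset.mem_union_right _ hu)⟩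

theorem ext_of_cyl_prod {s t : ℕ → List ℕ} {ρ ρ' : Measure (system s × system t)}
    [IsFiniteMeasure ρ] (huniv : ρ Set.univ = ρ' Set.univ)
    (h : ∀ i j, ρ (cyl s i ×ˢ cyl t j) = ρ' (cyl s i ×ˢ cyl t j)) : ρ = ρ' := by
  have hspan : ∀ s : ℕ → List ℕ, IsCountablySpanning (Set.range (cyl s)) := fun s =>
    ⟨fun _ => Set.univ, fun _ => ⟨⟨∅, Set.univ⟩, by simp [cyl]⟩, Set.iUnion_const _⟩
  refine ext_of_generate_finite _
    (generateFrom_eq_prod (generateFrom_range_cyl s) (generateFrom_range_cyl t)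
      (hspan s) (hspan t)).symm
    ((isPiSystem_range_cyl s).prod (isPiSystem_range_cyl t)) ?_ huniv
  rintro _ ⟨_, ⟨i, rfl⟩, _, ⟨j, rfl⟩, rfl⟩
  exact h i j

/-- An invariant measure that is moreover invariant under a nontrivial relative shift is a multiple
of the product measure. -/
theorem eq_smul_prod_of_relative_shift {α β : Type*} [MeasurableSpace α] [MeasurableSpace β]
    {μ : Measure α} {ν : Measure β} [IsProbabilityMeasure μ] [IsProbabilityMeasure ν]
    {f : α → α} {g : β → β} (hf : Ergodic f μ) (hg : Ergodic g ν) {k : ℕ}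
    (hk : Ergodic f^[k] μ ∨ Ergodic g^[k] ν) {ρ : Measure (α × β)} [IsFiniteMeasure ρ]
    (hρ : MeasurePreserving (Prod.map f g) ρ ρ)
    (hρ' : MeasurePreserving (Prod.map f^[k] id) ρ ρ ∨ MeasurePreserving (Prod.map id g^[k]) ρ ρ)
    (h1 : ρ.map Prod.fst ≪ μ) (h2 : ρ.map Prod.snd ≪ ν) : ρ = ρ Set.univ • μ.prod ν := by
  have hfk : Measurable (Prod.map f^[k] (id : β → β)) :=
    (hf.measurable.iterate k).prodMap measurable_id
  have hgk : Measurable (Prod.map (id : α → α) g^[k]) :=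
    measurable_id.prodMap (hg.measurable.iterate k)
  have hTk : MeasurePreserving (Prod.map f^[k] g^[k]) ρ ρ := by
    rw [← Prod.map_iterate]
    exact hρ.iterate k
  -- Cancelling the known factor from `Prod.map f^[k] g^[k]` gives invariance under the other one,
  -- so it does not matter which coordinate has the ergodic power.
  have hboth : MeasurePreserving (Prod.map f^[k] id) ρ ρ ∧
      MeasurePreserving (Prod.map id g^[k]) ρ ρ := by
    rcases hρ' with h | h
    · exact ⟨h, measurePreserving_of_comp h hgk hTk⟩
    · exact ⟨measurePreserving_of_comp h hfk hTk, h⟩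
  rcases hk with hk | hk
  · exact eq_smul_prod_of_measurePreserving_fst hf.measurable hk hg hρ hboth.1 h1 h2
  · exact eq_smul_prod_of_measurePreserving_snd hf hk hρ hboth.2 h1 h2

/-! ### Every joining is the product. -/

theorem eq_prod_of_isJoining {r : ℕ → ℕ} {s t : ℕ → List ℕ} (hs : IsParams r s)
    (ht : IsParams r t) {μ : Measure (system s)} (hμ : IsSystemMeasure s μ)
    {ν : Measure (system t)} (hν : IsSystemMeasure t ν) (hst : ∀ n, (s n).sum = (t n).sum) {S : ℕ}
    (hsS : ∀ n, ∀ a ∈ s n, a ≤ S) (htS : ∀ n, ∀ a ∈ t n, a ≤ S) {R : ℕ}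
    (hinc : {n | r n ≤ R ∧ Incompatible (s n) (t n)}.Infinite)
    (herg : ∀ k : ℕ, 1 < k → k ≤ S →
      Ergodic (systemShift s)^[k] μ ∨ Ergodic (systemShift t)^[k] ν)
    {m : Measure (system s × system t)}
    (hm : IsJoining (systemShift s) μ (systemShift t) ν m) : m = μ.prod ν := by
  have := hμ.isProbabilityMeasure
  have := hν.isProbabilityMeasure
  have hμe := hs.ergodic_systemShift hsS hμ
  have hνe := ht.ergodic_systemShift htS hν
  have hmp : IsProbabilityMeasure m := by
    refine ⟨?_⟩
    rw [← measure_univ (μ := μ), ← hm.map_fst, Measure.map_apply measurable_fst MeasurableSet.univ,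
      Set.preimage_univ]
  have hT := hm.invariant
  -- Word lengths exceed their level, so this gives h ≥ 8S for `exists_mismatch`, h/8 > 0, and h/8 →
  -- ∞.
  choose n hnI hn using fun k : ℕ => hinc.exists_gt (k + 8 * S + 8)
  have hh : ∀ k, k + 8 * S + 8 < (word s (n k)).length := fun k =>
    (hn k).trans (hs.lt_length_word (n k))
  set K := {κ : Fin (S + 1) × Fin (S + 1) // κ.1 ≠ κ.2} with hK
  obtain ⟨D, hDm, hDT, hDcover, hD⟩ := exists_invariant_cover hT
    (ι := (Σ F : Finset ℤ, Set (F → Fin 2)) × (Σ F : Finset ℤ, Set (F → Fin 2)))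
    (C := fun i => cyl s i.1 ×ˢ cyl t i.2)
    (fun i => (measurableSet_cyl s i.1).prod (measurableSet_cyl t i.2))
    (K := K)
    (R := fun κ => Prod.map (systemShift s)^[κ.1.2 - κ.1.1] (systemShift t)^[κ.1.1 - κ.1.2])
    (fun κ => ((measurable_systemShift s).iterate _).prodMap ((measurable_systemShift t).iterate _))
    (G := fun k κ => periodicPairs s t (word s (n k)).length ((word s (n k)).length / 8)
      κ.1.1 κ.1.2)
    (fun k κ => measurableSet_periodicPairs _ _ _ _ _ _)
    (by
      intro κ
      have hlim : Tendsto (fun k : ℕ => 2 / ((((word s (n k)).length / 8 : ℕ) : ℝ) + 1)) atTop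
          (𝓝 0) := by
        refine tendsto_const_nhds.div_atTop (tendsto_atTop_add_const_right _ _ ?_)
        refine tendsto_natCast_atTop_atTop.comp ?_
        refine tendsto_atTop_atTop.2 fun B => ⟨8 * B, fun k hk => ?_⟩
        have := hh k
        omega
      exact squeeze_zero (fun k => measureReal_nonneg) (fun k =>
        measureReal_preimage_symmDiff_le hT (measurableSet_periodicPairs _ _ _ _ _ _)
          fun z hz hz' j hj hj' => periodicPairs_exit hz hz' hj hj') hlim)
    (q := fun k κ => (word s (n k)).length + max (κ.1.1 : ℕ) κ.1.2)
    (by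
      rintro κ ⟨i, j⟩
      obtain ⟨M, hM, hM'⟩ := exists_natAbs_le i.1 j.1
      filter_upwards [eventually_ge_atTop (8 * (M + S))] with k hk
      have := hh k
      exact periodicPairs_inter_preimage (Nat.lt_succ_iff.1 κ.1.1.2) (Nat.lt_succ_iff.1 κ.1.2.2)
        (by omega) hM hM')
    -- The factor 16 absorbs integer division: h ≤ 16 (h/8) for h ≥ 8.
    (B := (4 * R + 8) * 16)
    (by
      intro k
      have hhk := hh k
      refine ⟨(word s (n k)).length / 8, (4 * R + 8) * (word s (n k)).length, by omega, ?_, ?_⟩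
      · rw [mul_assoc]
        exact Nat.mul_le_mul_left _ (by omega)
      · rintro ⟨x, y⟩
        obtain ⟨a, ha, b, hb, hab, c, hc, hper⟩ := exists_mismatch hs ht hst hsS htS (hnI k).1
          (hnI k).2 (by omega) x.2 y.2
        refine ⟨c, hc, fun i hi => Set.mem_iUnion.2
          ⟨⟨(⟨a, Nat.lt_succ_iff.2 ha⟩, ⟨b, Nat.lt_succ_iff.2 hb⟩),
            fun h => hab (congrArg Fin.val h)⟩, ?_⟩⟩
        rw [mem_periodicPairs_iterate]
        intro j hj
        have := hper i hi j hj
        push_cast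
        exact this)
  refine eq_of_invariant_cover hDm hDT hDcover fun κ E hE hTE hED => ?_
  obtain ⟨⟨a, b⟩, hab⟩ := κ
  replace hab : (a : ℕ) ≠ b := fun h => hab (Fin.ext h)
  have ha := Nat.lt_succ_iff.1 a.2
  have hb := Nat.lt_succ_iff.1 b.2
  have hTρ : MeasurePreserving (Prod.map (systemShift s) (systemShift t)) (m.restrict E)
      (m.restrict E) := by
    have := hT.restrict_preimage hE
    rwa [Measure.restrict_congr_set hTE] at this
  have hRm : Measurable (Prod.map (systemShift s)^[b - a] (systemShift t)^[a - b]) :=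
    ((measurable_systemShift s).iterate _).prodMap ((measurable_systemShift t).iterate _)
  -- `hD` gives invariance on products of cylinders only; these form a generating π-system.
  have hRρ : MeasurePreserving (Prod.map (systemShift s)^[b - a] (systemShift t)^[a - b])
      (m.restrict E) (m.restrict E) := by
    refine ⟨hRm, (ext_of_cyl_prod ?_ fun i j => ?_).symm⟩
    · rw [Measure.map_apply hRm MeasurableSet.univ, Set.preimage_univ]
    · have hC := (measurableSet_cyl s i).prod (measurableSet_cyl t j)
      rw [Measure.map_apply hRm hC, Measure.restrict_apply hC, Measure.restrict_apply (hRm hC),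
        Set.inter_comm, Set.inter_comm _ E]
      exact ((measureReal_eq_measureReal_iff).1 (hD _ E hE hTE hED (i, j))).symm
  have hρu : m.restrict E Set.univ = m E := Measure.restrict_apply_univ E
  have h1 : (m.restrict E).map Prod.fst ≪ μ := by
    rw [← hm.map_fst]
    exact Measure.restrict_le_self.absolutelyContinuous.map measurable_fst
  have h2 : (m.restrict E).map Prod.snd ≪ ν := by
    rw [← hm.map_snd]
    exact Measure.restrict_le_self.absolutelyContinuous.map measurable_snd
  have herg' : ∀ k : ℕ, 1 ≤ k → k ≤ S →
      Ergodic (systemShift s)^[k] μ ∨ Ergodic (systemShift t)^[k] ν := by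
    intro k hk hkS
    rcases eq_or_lt_of_le hk with rfl | hk
    · exact Or.inl hμe
    · exact herg k hk hkS
  rw [← hρu]
  -- One of the truncated differences `b - a` and `a - b` vanishes, so exactly one coordinate is
  -- shifted.
  rcases lt_or_gt_of_ne hab with h | h
  · rw [Nat.sub_eq_zero_of_le h.le, Function.iterate_zero] at hRρ
    exact eq_smul_prod_of_relative_shift hμe hνe (herg' (b - a) (by omega) (by omega)) hTρ
      (Or.inl hRρ) h1 h2
  · rw [Nat.sub_eq_zero_of_le h.le, Function.iterate_zero] at hRρ
    exact eq_smul_prod_of_relative_shift hμe hνe (herg' (a - b) (by omega) (by omega)) hTρ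
      (Or.inr hRρ) h1 h2

end RankOne

theorem theorem3p2
    (r : ℕ → ℕ) (s t : ℕ → List ℕ)
    (hs : RankOne.IsParams r s) (ht : RankOne.IsParams r t)
    (μ : MeasureTheory.Measure (RankOne.system s)) (hμ : RankOne.IsSystemMeasure s μ)
    (ν : MeasureTheory.Measure (RankOne.system t)) (hν : RankOne.IsSystemMeasure t ν)
    (commensurate : ∀ n, (s n).sum = (t n).sum)
    (S : ℕ) (bounded : ∀ n, (∀ a ∈ s n, a ≤ S) ∧ (∀ a ∈ t n, a ≤ S))
    (R : ℕ) (incompatible : {n | r n ≤ R ∧ RankOne.Incompatible (s n) (t n)}.Infinite)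
    (ergodic : ∀ k : ℕ, 1 < k → k ≤ S →
      Ergodic (RankOne.systemShift s)^[k] μ ∨ Ergodic (RankOne.systemShift t)^[k] ν) :
    RankOne.AreDisjoint (RankOne.systemShift s) μ (RankOne.systemShift t) ν := by
  intro m
  constructor
  · exact RankOne.eq_prod_of_isJoining hs ht hμ hν commensurate (fun n => (bounded n).1)
      (fun n => (bounded n).2) incompatible ergodic
  · rintro rfl
    have := hμ.isProbabilityMeasure
    have := hν.isProbabilityMeasure
    exact ⟨hμ.invariant.prod hν.invariant, by simp, by simp⟩
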